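/- Setting. Let $G=(L,R,E)$ be a finite bipartite graph with offline side $L$, online side $R$ and non-negative weights $(w_v)_{v\in L}$; the weight of a matching is the sum of $w_v$ over its offline vertices $v$, and $\mathrm{OPT}(G,w)$ is the maximum weight of a matching. Independent random arrival with $m$ stages. Every online vertex $u$ draws independently and uniformly a stage $j_u\in\{1,\dots,m\}$. Vertices of earlier stages arrive first; within a stage the order is arbitrary but consistent: if a vertex is switched from its stage to another one, the relative order of the vertices remaining in its old stage does not change. Ranking. Every offline vertex $v$ draws independently a uniform rank $y_v\in[0,1]$. Vertex-weighted Ranking is given by a function $f:\{1,\dots,m\}\times[0,1]\to[0,1]$ that is non-increasing in the first argument, non-decreasing in the second, and satisfies $f(i,1)=1$ for all $i$: on arrival, $u$ is matched to an unmatched neighbour $v$ (if one exists) maximizing $w_v\,(1-f(j_u,y_v))$, ties being broken by an arbitrary fixed linear order on $L$. Classical Ranking on unweighted graphs ($w\equiv 1$) matches $u$ to its unmatched neighbour of smallest rank. An algorithm is $c$-competitive if for every graph (with weights) and every consistent arrival order the expected weight of its matching is at least $c\cdot\mathrm{OPT}(G,w)$. Theorem. For $m=2$ there is a function $f$, independent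 of the graph, the weights and the arrival order, such that vertex-weighted Ranking with $f$ is $0.6656$-competitive; and classical Ranking is $0.6656$-competitive on unweighted graphs. For $m=3$ both statements hold with $0.6763$ in place of $0.6656$. Both constants exceed $1-1/e$. -/

import Mathlib

open MeasureTheory

universe u v

noncomputable section

namespace StageRanking

/-! A bipartite graph with offline side `L` and online side `R` is given by its edge relation
`E : L → R → Prop`; a vertex weighting is a function `w : L → ℝ`. -/

/-- `M` is a matching of the bipartite graph `E`. -/
structure IsMatching {L : Type u} {R : Type v} (E : L → R → Prop) (M : Finset (L × R)) :
    Prop where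
  edge : ∀ p ∈ M, E p.1 p.2
  offline : ∀ p ∈ M, ∀ q ∈ M, p.1 = q.1 → p = q
  online : ∀ p ∈ M, ∀ q ∈ M, p.2 = q.2 → p = q

theorem isMatching_empty {L : Type u} {R : Type v} (E : L → R → Prop) :
    IsMatching E (∅ : Finset (L × R)) :=
  ⟨by simp, by simp, by simp⟩

/-- The weight of a matching: the sum of the weights of its offline vertices. -/
def matchingWeight {L : Type u} {R : Type v} (w : L → ℝ) (M : Finset (L × R)) : ℝ :=
  ∑ p ∈ M, w p.1

open Classical in
/-- The maximum weight of a matching in the graph (the offline optimum). -/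
def opt {L : Type u} {R : Type v} [Fintype L] [Fintype R] (E : L → R → Prop) (w : L → ℝ) : ℝ :=
  (Finset.univ.filter fun M : Finset (L × R) => IsMatching E M).sup'
    ⟨∅, by simpa using isMatching_empty E⟩ (matchingWeight w)

/-- An arrival order for `m` stages. For every assignment `s` of the online vertices to stages,
`seq s` is the resulting arrival sequence (`seq s t` is the vertex that arrives as number `t`).
Earlier stages come first, and inside a stage the order is arbitrary but consistent: if a vertex
`x` is switched from its stage to another one, the relative order of the vertices that remain in
its old stage does not change. -/
structure ArrivalOrder (m : ℕ) (R : Type v) [Fintype R] where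
  seq : (R → Fin m) → (Fin (Fintype.card R) ≃ R)
  stage_lt : ∀ (s : R → Fin m) (a b : R), s a < s b → (seq s).symm a < (seq s).symm b
  consistent : ∀ (s s' : R → Fin m) (x : R), (∀ z, z ≠ x → s' z = s z) →
    ∀ a b : R, a ≠ x → b ≠ x → s a = s x → s b = s x →
      ((seq s').symm a < (seq s').symm b ↔ (seq s).symm a < (seq s).symm b)

open Classical in
/-- The neighbours of the online vertex `u` that are not covered by the matching `M`. -/
def available {L : Type u} {R : Type v} [Fintype L] (E : L → R → Prop) (M : Finset (L × R))
    (u : R) : Finset L :=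
  Finset.univ.filter fun a => E a u ∧ ∀ p ∈ M, p.1 ≠ a

open Classical in
/-- The available neighbours of `u` of maximum utility. -/
def favourites {L : Type u} {R : Type v} [Fintype L] (E : L → R → Prop) (util : R → L → ℝ)
    (M : Finset (L × R)) (u : R) : Finset L :=
  (available E M u).filter fun a => ∀ b ∈ available E M u, util u b ≤ util u a

open Classical in
/-- The arrival of the online vertex `u`: it is matched to its available neighbour of maximum
utility, if it has an available neighbour at all. Ties are broken by the linear order of `L`,
which is arbitrary. -/
def step {L : Type u} {R : Type v} [Fintype L] [LinearOrder L] (E : L → R → Prop)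
    (util : R → L → ℝ) (M : Finset (L × R)) (u : R) : Finset (L × R) :=
  if h : (favourites E util M u).Nonempty then
    insert ((favourites E util M u).min' h, u) M
  else M

/-- The matching built when the online vertices arrive in the order `seq`. -/
def run {L : Type u} {R : Type v} [Fintype L] [LinearOrder L] [Fintype R] (E : L → R → Prop)
    (util : R → L → ℝ) (seq : Fin (Fintype.card R) ≃ R) : Finset (L × R) :=
  (List.ofFn seq).foldl (step E util) ∅

/-- The expected weight of the matching built by the algorithm, when every online vertex draws its
stage independently and uniformly from the `m` stages, and every offline vertex draws its rank
independently and uniformly from `[0,1]`. The utilities may depend on stages and ranks. -/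
def expectedWeight {L : Type u} {R : Type v} [Fintype L] [LinearOrder L] [Fintype R]
    [DecidableEq R] {m : ℕ} (A : ArrivalOrder m R) (E : L → R → Prop) (w : L → ℝ)
    (util : (R → Fin m) → (L → unitInterval) → R → L → ℝ) : ℝ :=
  (∑ s : R → Fin m, ∫ y : L → unitInterval, matchingWeight w (run E (util s y) (A.seq s)))
    / Fintype.card (R → Fin m)

/-- The functions `f` (of stage and rank) that define a vertex-weighted Ranking algorithm:
non-increasing in the stage, non-decreasing in the rank, and equal to `1` at rank `1`. -/
structure IsPrice {m : ℕ} (f : Fin m → unitInterval → unitInterval) : Prop where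
  antitone_stage : ∀ y, Antitone fun i => f i y
  monotone_rank : ∀ i, Monotone (f i)
  one : ∀ i, f i 1 = 1

/-- Vertex-weighted Ranking: an online vertex `u` takes the available neighbour `a` that maximizes
`w a * (1 - f (stage of u) (rank of a))`. -/
def weightedUtil {L : Type u} {R : Type v} {m : ℕ} (w : L → ℝ)
    (f : Fin m → unitInterval → unitInterval) (s : R → Fin m) (y : L → unitInterval)
    (u : R) (a : L) : ℝ :=
  w a * (1 - (f (s u) (y a) : ℝ))

/-- Classical Ranking: an online vertex takes the available neighbour of smallest rank. -/
def classicalUtil {L : Type u} {R : Type v} {m : ℕ} (_s : R → Fin m) (y : L → unitInterval)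
    (_u : R) (a : L) : ℝ :=
  -(y a : ℝ)

/-- Vertex-weighted Ranking with the function `f` is `c`-competitive under independent random
arrival with `m` stages: on every finite vertex-weighted bipartite graph, for every consistent
arrival order, its expected weight is at least `c` times the maximum weight of a matching. -/
def WeightedCompetitive (m : ℕ) (f : Fin m → unitInterval → unitInterval) (c : ℝ) : Prop :=
  ∀ (L : Type u) (R : Type v) [Fintype L] [LinearOrder L] [Fintype R] [DecidableEq R]
    (E : L → R → Prop) (w : L → ℝ) (A : ArrivalOrder m R), (∀ a, 0 ≤ w a) →
    c * opt E w ≤ expectedWeight A E w (weightedUtil w f)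

/-- Classical Ranking is `c`-competitive on unweighted graphs under independent random arrival
with `m` stages. -/
def ClassicalCompetitive (m : ℕ) (c : ℝ) : Prop :=
  ∀ (L : Type u) (R : Type v) [Fintype L] [LinearOrder L] [Fintype R] [DecidableEq R]
    (E : L → R → Prop) (A : ArrivalOrder m R),
    c * opt E (fun _ => 1) ≤ expectedWeight A E (fun _ => 1) classicalUtil

end StageRanking

end

noncomputable section

namespace StageRanking

section Greedy

variable {L : Type u} {R : Type v}

/-- The offline vertices covered by `M`. -/
def covered (M : Finset (L × R)) : Set L := {a | ∃ p ∈ M, p.1 = a}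

theorem covered_mono {M N : Finset (L × R)} (h : M ⊆ N) : covered M ⊆ covered N :=
  fun _ ⟨p, hp, e⟩ => ⟨p, h hp, e⟩

theorem covered_insert [DecidableEq (L × R)] (M : Finset (L × R)) (a : L) (x : R) :
    covered (insert (a, x) M) = insert a (covered M) := by
  ext b
  simp only [covered, Finset.mem_insert, Set.mem_ofPred_eq, Set.mem_insert_iff]
  constructor
  · rintro ⟨p, rfl | hp, rfl⟩
    · exact Or.inl rfl
    · exact Or.inr ⟨p, hp, rfl⟩
  · rintro (rfl | ⟨p, hp, rfl⟩)
    · exact ⟨_, Or.inl rfl, rfl⟩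
    · exact ⟨p, Or.inr hp, rfl⟩

theorem mem_available [Fintype L] {E : L → R → Prop} {M : Finset (L × R)} {x : R} {a : L} :
    a ∈ available E M x ↔ E a x ∧ a ∉ covered M := by
  simp only [available, covered, Finset.mem_filter, Finset.mem_univ, true_and, Set.mem_ofPred_eq,
    not_exists, not_and, ne_eq]

variable [LinearOrder L]

/-- `a` is the vertex to which `x` is matched on arrival. -/
structure IsPick (E : L → R → Prop) (util : R → L → ℝ) (M : Finset (L × R)) (x : R) (a : L) :
    Prop where
  edge : E a x
  free : a ∉ covered M
  best : ∀ b, E b x → b ∉ covered M → util x b < util x a ∨ util x b = util x a ∧ a ≤ b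

theorem IsPick.le {E : L → R → Prop} {util : R → L → ℝ} {M : Finset (L × R)} {x : R} {a b : L}
    (h : IsPick E util M x a) (hE : E b x) (hb : b ∉ covered M) : util x b ≤ util x a := by
  rcases h.best b hE hb with h | h
  · exact h.le
  · exact h.1.le

theorem IsPick.of_worse {E : L → R → Prop} {U U' : R → L → ℝ} {c : L} {M : Finset (L × R)}
    {x : R} {a : L} (h : IsPick E U M x a) (hne : a ≠ c) (hU : ∀ b, b ≠ c → U x b = U' x b)
    (hc : U' x c ≤ U x c) : IsPick E U' M x a := by
  refine ⟨h.edge, h.free, fun b hE hb => ?_⟩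
  rw [← hU a hne]
  by_cases hbc : b = c
  · subst hbc
    rcases h.best b hE hb with h' | ⟨h', h''⟩
    · exact Or.inl (hc.trans_lt h')
    · rw [h'] at hc
      rcases hc.lt_or_eq with h3 | h3
      · exact Or.inl h3
      · exact Or.inr ⟨h3, h''⟩
  · rw [← hU b hbc]; exact h.best b hE hb

theorem IsPick.of_better {E : L → R → Prop} {U U' : R → L → ℝ} {c : L} {M : Finset (L × R)}
    {x : R} (h : IsPick E U M x c) (hU : ∀ b, b ≠ c → U x b = U' x b)
    (hc : U x c ≤ U' x c) : IsPick E U' M x c := by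
  refine ⟨h.edge, h.free, fun b hE hb => ?_⟩
  by_cases hbc : b = c
  · subst hbc; exact Or.inr ⟨rfl, le_rfl⟩
  · rw [← hU b hbc]
    rcases h.best b hE hb with h' | ⟨h', h''⟩
    · exact Or.inl (h'.trans_le hc)
    · rw [← h'] at hc
      rcases hc.lt_or_eq with h3 | h3
      · exact Or.inl h3
      · exact Or.inr ⟨h3, h''⟩

variable [Fintype L]

open Classical in
theorem step_eq_of_isPick {E : L → R → Prop} {util : R → L → ℝ} {M : Finset (L × R)} {x : R}
    {a : L} (h : IsPick E util M x a) : step E util M x = insert (a, x) M := by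
  have ha : a ∈ favourites E util M x := by
    simp only [favourites, Finset.mem_filter, mem_available]
    exact ⟨⟨h.edge, h.free⟩, fun b hb => h.le hb.1 hb.2⟩
  have hne : (favourites E util M x).Nonempty := ⟨a, ha⟩
  have hmin : (favourites E util M x).min' hne = a := by
    refine le_antisymm (Finset.min'_le _ _ ha) (Finset.le_min' _ _ _ fun b hb => ?_)
    simp only [favourites, Finset.mem_filter, mem_available] at hb
    rcases h.best b hb.1.1 hb.1.2 with h' | h'
    · exact absurd (hb.2 a ⟨h.edge, h.free⟩) (not_le.2 h')
    · exact h'.2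
  rw [step, dif_pos hne, hmin]

theorem exists_isPick {E : L → R → Prop} (util : R → L → ℝ) {M : Finset (L × R)} {x : R} {b : L}
    (hE : E b x) (hb : b ∉ covered M) : ∃ a, IsPick E util M x a := by
  obtain ⟨c, hc, hmax⟩ := Finset.exists_max_image (available E M x) (util x)
    ⟨b, mem_available.2 ⟨hE, hb⟩⟩
  have hne : (favourites E util M x).Nonempty :=
    ⟨c, by simp only [favourites, Finset.mem_filter]; exact ⟨hc, hmax⟩⟩
  have hmem := Finset.min'_mem _ hne
  have hle := fun d hd => Finset.min'_le (favourites E util M x) d hd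
  set a := (favourites E util M x).min' hne
  simp only [favourites, Finset.mem_filter, mem_available] at hmem
  refine ⟨a, hmem.1.1, hmem.1.2, fun d hd hd' => ?_⟩
  rcases (hmem.2 d ⟨hd, hd'⟩).lt_or_eq with h | h
  · exact Or.inl h
  · refine Or.inr ⟨h, hle d ?_⟩
    simp only [favourites, Finset.mem_filter, mem_available]
    exact ⟨⟨hd, hd'⟩, fun e he => h ▸ hmem.2 e he⟩

theorem step_eq_self {E : L → R → Prop} {util : R → L → ℝ} {M : Finset (L × R)} {x : R}
    (h : ∀ b, E b x → b ∈ covered M) : step E util M x = M := by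
  refine dif_neg ?_
  rintro ⟨b, hb⟩
  simp only [favourites, Finset.mem_filter, mem_available] at hb
  exact hb.1.2 (h b hb.1.1)

open Classical in
theorem step_cases (E : L → R → Prop) (util : R → L → ℝ) (M : Finset (L × R)) (x : R) :
    ((∀ b, E b x → b ∈ covered M) ∧ step E util M x = M) ∨
      ∃ a, IsPick E util M x a ∧ step E util M x = insert (a, x) M := by
  by_cases h : ∀ b, E b x → b ∈ covered M
  · exact Or.inl ⟨h, step_eq_self h⟩
  · push Not at h
    obtain ⟨b, hE, hb⟩ := h
    obtain ⟨a, ha⟩ := exists_isPick util hE hb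
    exact Or.inr ⟨a, ha, step_eq_of_isPick ha⟩

theorem subset_step (E : L → R → Prop) (util : R → L → ℝ) (M : Finset (L × R)) (x : R) :
    M ⊆ step E util M x := by
  classical
  rcases step_cases E util M x with ⟨_, h⟩ | ⟨a, _, h⟩
  · rw [h]
  · rw [h]; exact Finset.subset_insert _ _

theorem step_congr (E : L → R → Prop) {util util' : R → L → ℝ} (M : Finset (L × R)) {x : R}
    (h : ∀ a b, util x a ≤ util x b ↔ util' x a ≤ util' x b) :
    step E util M x = step E util' M x := by
  have : favourites E util M x = favourites E util' M x := by
    ext a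
    simp only [favourites, Finset.mem_filter, h]
  unfold step
  simp only [this]

theorem subset_foldl_step (E : L → R → Prop) (util : R → L → ℝ) (l : List R)
    (M : Finset (L × R)) : M ⊆ l.foldl (step E util) M := by
  induction l generalizing M with
  | nil => exact subset_rfl
  | cons x l ih => exact (subset_step E util M x).trans (ih _)

theorem foldl_step_congr (E : L → R → Prop) {util util' : R → L → ℝ} (l : List R)
    (M : Finset (L × R))
    (h : ∀ x ∈ l, ∀ a b, util x a ≤ util x b ↔ util' x a ≤ util' x b) :
    l.foldl (step E util) M = l.foldl (step E util') M := by
  induction l generalizing M with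
  | nil => rfl
  | cons x l ih =>
    rw [List.foldl_cons, List.foldl_cons, step_congr E M (h x (by simp)),
      ih _ fun z hz => h z (by simp [hz])]

/-- Every edge built while the list `l` arrives ends in `l`. -/
theorem mem_foldl_step {E : L → R → Prop} {util : R → L → ℝ} {l : List R} {M : Finset (L × R)}
    {p : L × R} (hp : p ∈ l.foldl (step E util) M) : p ∈ M ∨ p.2 ∈ l := by
  classical
  induction l generalizing M with
  | nil => exact Or.inl hp
  | cons x l ih =>
    rcases ih hp with h | h
    · rcases step_cases E util M x with ⟨_, e⟩ | ⟨a, _, e⟩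
      · exact Or.inl (e ▸ h)
      · rw [e, Finset.mem_insert] at h
        rcases h with rfl | h
        · exact Or.inr (by simp)
        · exact Or.inl h
    · exact Or.inr (by simp [h])

theorem covered_step_subset {E : L → R → Prop} {U U' : R → L → ℝ} {S : Set L}
    {M M' : Finset (L × R)} {x : R} (hU : ∀ a ∉ S, U x a = U' x a)
    (hM : covered M ⊆ covered M' ∪ S) (hS : Disjoint (covered (step E U' M' x)) S) :
    covered (step E U M x) ⊆ covered (step E U' M' x) ∪ S := by
  classical
  have hsub := covered_mono (subset_step E U' M' x)
  have hold : covered M ⊆ covered (step E U' M' x) ∪ S :=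
    hM.trans (Set.union_subset_union_left _ hsub)
  rcases step_cases E U M x with ⟨_, e⟩ | ⟨a, ha, e⟩
  · rwa [e]
  rw [e, covered_insert]
  refine Set.insert_subset ?_ hold
  by_contra hcon
  rw [Set.mem_union, not_or] at hcon
  obtain ⟨ha1, haS⟩ := hcon
  obtain ⟨b, hb⟩ := exists_isPick U' ha.edge (fun h => ha1 (hsub h))
  have hbc : b ∈ covered (step E U' M' x) := by
    rw [step_eq_of_isPick hb, covered_insert]; exact Set.mem_insert _ _
  have hbS : b ∉ S := fun h => Set.disjoint_left.1 hS hbc h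
  have hbM : b ∉ covered M := fun h => (hM h).elim hb.free hbS
  have h1 := ha.best b hb.edge hbM
  have h2 := hb.best a ha.edge (fun h => ha1 (hsub h))
  rw [hU a haS, hU b hbS] at h1
  have : a = b := by
    rcases h1 with h1 | ⟨h1, h1'⟩ <;> rcases h2 with h2 | ⟨h2, h2'⟩
    · exact absurd h1 (not_lt.2 h2.le)
    · exact absurd h1 (by rw [h2]; exact lt_irrefl _)
    · exact absurd h2 (by rw [h1]; exact lt_irrefl _)
    · exact le_antisymm h1' h2'
  exact ha1 (this ▸ hbc)

theorem covered_foldl_step_subset {E : L → R → Prop} {U U' : R → L → ℝ} {S : Set L}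
    (l : List R) {M M' : Finset (L × R)} (hU : ∀ x, ∀ a ∉ S, U x a = U' x a)
    (hM : covered M ⊆ covered M' ∪ S)
    (hS : Disjoint (covered (l.foldl (step E U') M')) S) :
    covered (l.foldl (step E U) M) ⊆ covered (l.foldl (step E U') M') ∪ S := by
  induction l generalizing M M' with
  | nil => exact hM
  | cons x l ih =>
    refine ih (covered_step_subset (hU x) hM ?_) hS
    exact hS.mono_left (covered_mono (subset_foldl_step E U' l _))

/-- More covered vertices before a sequence of arrivals yield more covered vertices after it. -/
theorem covered_foldl_step_mono {E : L → R → Prop} {U : R → L → ℝ} (l : List R)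
    {M M' : Finset (L × R)} (hM : covered M ⊆ covered M') :
    covered (l.foldl (step E U) M) ⊆ covered (l.foldl (step E U) M') := by
  have := covered_foldl_step_subset (E := E) (U := U) (U' := U) (S := ∅) l (M := M) (M' := M')
    (fun _ _ _ => rfl) (by simpa using hM) (by simp)
  simpa using this

theorem foldl_step_eq_of_worse {E : L → R → Prop} {U U' : R → L → ℝ} {c : L} (l : List R)
    {M : Finset (L × R)} (hU : ∀ x b, b ≠ c → U x b = U' x b) (hc : ∀ x, U' x c ≤ U x c)
    (h : c ∉ covered (l.foldl (step E U) M)) :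
    l.foldl (step E U') M = l.foldl (step E U) M := by
  classical
  induction l generalizing M with
  | nil => rfl
  | cons x l ih =>
    have hstep : step E U' M x = step E U M x := by
      rcases step_cases E U M x with ⟨h1, e⟩ | ⟨a, ha, e⟩
      · rw [e, step_eq_self h1]
      · have hne : a ≠ c := by
          rintro rfl
          refine h (covered_mono (subset_foldl_step E U l _) ?_)
          rw [e, covered_insert]; exact Set.mem_insert _ _
        rw [e, step_eq_of_isPick (ha.of_worse hne (hU x) (hc x))]
    rw [List.foldl_cons, List.foldl_cons, hstep]
    exact ih h

end Greedy

theorem exists_threshold (n : ℕ) (p : ℕ → Prop) (hp : ∀ k k', k ≤ k' → p k' → p k) :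
    ∃ t ≤ n, ∀ k < n, p k ↔ k < t := by
  induction n with
  | zero => exact ⟨0, le_rfl, by simp⟩
  | succ n ih =>
    by_cases h : p n
    · exact ⟨n + 1, le_rfl, fun k hk => iff_of_true (hp k n (by omega) h) hk⟩
    · obtain ⟨t, ht, ht'⟩ := ih
      refine ⟨t, by omega, fun k hk => ?_⟩
      rcases Nat.lt_succ_iff_lt_or_eq.1 hk with hk | rfl
      · exact ht' k hk
      · exact iff_of_false h (by omega)

/-- The structure of the matchings that arise when the stage `j` of one online vertex `x` and the
level `k` of one offline vertex `c` vary. The other online vertices arrive in the order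
`pre j ++ post j`, and `x` arrives between `pre j` and `post j`. There are thresholds such that
`c` is matched before `x` for `k < β j`, and `x` is matched to `c` for `β j ≤ k < θ j`. -/
theorem exists_thresholds {L : Type u} {R : Type v} [Fintype L] [LinearOrder L] {m : ℕ}
    (E : L → R → Prop) (W : ℕ → R → L → ℝ) (P : Fin m → ℕ → R → L → ℝ) {c : L} {x : R}
    (hE : E c x) (n : ℕ)
    (hW : ∀ k k' z a, a ≠ c → W k z a = W k' z a)
    (hWc : ∀ k k' z, k ≤ k' → W k' z c ≤ W k z c)
    (hP : ∀ j k k' z a, a ≠ c → P j k z a = P j k' z a)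
    (hPc : ∀ j k k' z, k ≤ k' → P j k' z c ≤ P j k z c)
    (σ : List R) (pre post : Fin m → List R) (hσ : ∀ j, pre j ++ post j = σ)
    (hpre : ∀ i j, i ≤ j → pre i <+: pre j) (run' : Fin m → ℕ → Finset (L × R))
    (hrun : ∀ j k, run' j k = (post j).foldl (step E (W k))
      (step E (P j k) ((pre j).foldl (step E (W k)) ∅) x)) :
    ∃ β θ : Fin m → ℕ, Monotone β ∧ (∀ j, β j ≤ θ j ∧ θ j ≤ n) ∧ ∀ j, ∀ k < n,
      (β j ≤ k → k < θ j → (c, x) ∈ run' j k) ∧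
      (¬ (β j ≤ k ∧ k < θ j) → θ j < n →
        ∃ b ≠ c, (b, x) ∈ run' j k ∧ P j (θ j) x c ≤ P j (θ j) x b) ∧
      ∀ i, k < β i → ∃ z, (c, z) ∈ run' j k ∧ (z ∈ pre i ∨ z = x ∧ j ≤ i) := by
  classical
  set N : Fin m → ℕ → Finset (L × R) := fun j k => (pre j).foldl (step E (W k)) ∅ with hN
  have hNeq : ∀ j k k', k ≤ k' → c ∉ covered (N j k) → N j k' = N j k := fun j k k' hk h =>
    foldl_step_eq_of_worse (pre j) (fun z b hb => hW k k' z b hb) (fun z => hWc k k' z hk) h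
  have hdown : ∀ j k k', k ≤ k' → c ∈ covered (N j k') → c ∈ covered (N j k) := by
    intro j k k' hk h
    by_contra hcon
    rw [hNeq j k k' hk hcon] at h
    exact hcon h
  choose β hβn hβ using fun j => exists_threshold n (fun k => c ∈ covered (N j k)) (hdown j)
  have hpickdown : ∀ j k k', k ≤ k' →
      (c ∈ covered (N j k') ∨ IsPick E (P j k') (N j k') x c) →
      (c ∈ covered (N j k) ∨ IsPick E (P j k) (N j k) x c) := by
    intro j k k' hk h
    by_cases hc : c ∈ covered (N j k)
    · exact Or.inl hc
    · rw [hNeq j k k' hk hc] at h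
      rcases h with h | h
      · exact absurd h hc
      · exact Or.inr (h.of_better (fun b hb => hP j k' k x b hb) (hPc j k k' x hk))
  choose θ hθn hθ using fun j => exists_threshold n
    (fun k => c ∈ covered (N j k) ∨ IsPick E (P j k) (N j k) x c) (hpickdown j)
  have hNpre : ∀ i j k, i ≤ j → covered (N i k) ⊆ covered (N j k) := by
    intro i j k hij
    obtain ⟨t, ht⟩ := hpre i j hij
    simp only [hN, ← ht, List.foldl_append]
    exact covered_mono (subset_foldl_step _ _ _ _)
  have hsub : ∀ j k, step E (P j k) (N j k) x ⊆ run' j k := fun j k => by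
    rw [hrun]; exact subset_foldl_step _ _ _ _
  refine ⟨β, θ, ?_, fun j => ⟨?_, hθn j⟩, fun j k hk => ⟨?_, ?_, ?_⟩⟩
  · intro i j hij
    by_contra! hlt
    have h1 : c ∈ covered (N i (β j)) := (hβ i _ (hlt.trans_le (hβn i))).2 hlt
    have h2 := (hβ j _ (hlt.trans_le (hβn i))).1 (hNpre i j _ hij h1)
    exact lt_irrefl _ h2
  · by_contra! hlt
    have h1 : c ∈ covered (N j (θ j)) := (hβ j _ (hlt.trans_le (hβn j))).2 hlt
    exact lt_irrefl _ ((hθ j _ (hlt.trans_le (hβn j))).1 (Or.inl h1))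
  · intro h1 h2
    have hc : c ∉ covered (N j k) := fun h => absurd ((hβ j k hk).1 h) (not_lt.2 h1)
    have hp := ((hθ j k hk).2 h2).resolve_left hc
    refine hsub j k ?_
    rw [step_eq_of_isPick hp]
    exact Finset.mem_insert_self _ _
  · intro hnot hθj
    have hθc : ¬ (c ∈ covered (N j (θ j)) ∨ IsPick E (P j (θ j)) (N j (θ j)) x c) := fun h =>
      lt_irrefl _ ((hθ j _ hθj).1 h)
    rw [not_or] at hθc
    obtain ⟨b, hb⟩ := exists_isPick (P j (θ j)) hE hθc.1
    have hbc : b ≠ c := by rintro rfl; exact hθc.2 hb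
    have hbc' : P j (θ j) x c ≤ P j (θ j) x b := hb.le hE hθc.1
    suffices h : ∃ d ≠ c, IsPick E (P j k) (N j k) x d ∧ b ∉ covered (N j k) by
      obtain ⟨d, hd, hpick, hfree⟩ := h
      refine ⟨d, hd, hsub j k ?_, hbc'.trans ?_⟩
      · rw [step_eq_of_isPick hpick]; exact Finset.mem_insert_self _ _
      · rw [hP j (θ j) k x b hbc, hP j (θ j) k x d hd]
        exact hpick.le hb.edge hfree
    by_cases hck : c ∈ covered (N j k)
    · have hbk : b ∉ covered (N j k) := by
        intro h
        have := covered_foldl_step_subset (E := E) (U := W k) (U' := W (θ j)) (S := {c}) (pre j)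
          (M := ∅) (M' := ∅) (fun z a ha => hW _ _ z a ha) Set.subset_union_left
          (Set.disjoint_singleton_right.2 hθc.1) h
        rcases this with h | h
        · exact hb.free h
        · exact hbc h
      obtain ⟨d, hd⟩ := exists_isPick (P j k) hb.edge hbk
      exact ⟨d, fun h => hd.free (h ▸ hck), hd, hbk⟩
    · have hkθ : θ j ≤ k := by
        have h1 : β j ≤ k := not_lt.1 fun h => hck ((hβ j k hk).2 h)
        exact not_lt.1 fun h => hnot ⟨h1, h⟩
      have hNk : N j k = N j (θ j) := hNeq j _ _ hkθ hθc.1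
      have hbk : b ∉ covered (N j k) := by rw [hNk]; exact hb.free
      obtain ⟨d, hd⟩ := exists_isPick (P j k) hb.edge hbk
      refine ⟨d, ?_, hd, hbk⟩
      rintro rfl
      exact absurd ((hθ j k hk).1 (Or.inr hd)) (not_lt.2 hkθ)
  · intro i hki
    have hci : c ∈ covered (N i k) := (hβ i k hk).2 hki
    rcases le_total i j with hij | hij
    · obtain ⟨⟨a, z⟩, hz, rfl⟩ := hci
      refine ⟨z, ?_, Or.inl ((mem_foldl_step hz).resolve_left (by simp))⟩
      obtain ⟨t, ht⟩ := hpre i j hij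
      refine hsub j k (subset_step _ _ _ _ ?_)
      simp only [hN, ← ht, List.foldl_append]
      exact subset_foldl_step _ _ _ _ hz
    · obtain ⟨t, ht⟩ := hpre j i hij
      have hpost : post j = t ++ post i := by
        have h1 := hσ j
        rw [← hσ i, ← ht, List.append_assoc] at h1
        exact List.append_cancel_left h1
      have h2 : c ∈ covered (t.foldl (step E (W k)) (step E (P j k) (N j k) x)) := by
        refine covered_foldl_step_mono t (covered_mono (subset_step _ _ _ _)) ?_
        simpa only [hN, ← ht, List.foldl_append] using hci
      obtain ⟨⟨a, z⟩, hz, rfl⟩ := h2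
      refine ⟨z, ?_, ?_⟩
      · rw [hrun, hpost, List.foldl_append]
        exact subset_foldl_step _ _ _ _ hz
      · rcases mem_foldl_step hz with h | h
        · rcases step_cases E (P j k) (N j k) x with ⟨_, e⟩ | ⟨d, _, e⟩
          · rw [e] at h
            exact Or.inl (ht ▸ List.mem_append_left _ ((mem_foldl_step h).resolve_left (by simp)))
          · rw [e, Finset.mem_insert] at h
            rcases h with h | h
            · exact Or.inr ⟨(Prod.ext_iff.1 h).2, hij⟩
            · exact Or.inl
                (ht ▸ List.mem_append_left _ ((mem_foldl_step h).resolve_left (by simp)))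
        · exact Or.inl (ht ▸ List.mem_append_right _ h)

/-- When one online vertex `x` changes its stage, the other vertices keep their arrival order. -/
theorem ArrivalOrder.lt_iff_lt_update {m : ℕ} {R : Type v} [Fintype R] [DecidableEq R]
    (A : ArrivalOrder m R) (s : R → Fin m) (x : R) (i j : Fin m) {a b : R} (ha : a ≠ x)
    (hb : b ≠ x) :
    (A.seq (Function.update s x i)).symm a < (A.seq (Function.update s x i)).symm b ↔
      (A.seq (Function.update s x j)).symm a < (A.seq (Function.update s x j)).symm b := by
  have key : ∀ i, s a = s b →
      ((A.seq (Function.update s x i)).symm a < (A.seq (Function.update s x i)).symm b ↔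
        (A.seq (Function.update s x (s a))).symm a <
          (A.seq (Function.update s x (s a))).symm b) := by
    intro i hab
    refine A.consistent (Function.update s x (s a)) (Function.update s x i) x ?_ a b ha hb ?_ ?_
    · intro z hz; simp [hz]
    · simp [ha]
    · simp [hb, hab]
  rcases lt_trichotomy (s a) (s b) with h | h | h
  · refine iff_of_true ?_ ?_ <;> exact A.stage_lt _ a b (by simpa [ha, hb] using h)
  · exact (key i h).trans (key j h).symm
  · refine iff_of_false ?_ ?_ <;>
      exact (A.stage_lt _ b a (by simpa [ha, hb] using h)).not_gt

theorem ArrivalOrder.pairwise_ofFn {m : ℕ} {R : Type v} [Fintype R] (A : ArrivalOrder m R)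
    (s : R → Fin m) :
    (List.ofFn (A.seq s)).Pairwise fun a b => (A.seq s).symm a < (A.seq s).symm b := by
  rw [List.pairwise_ofFn]
  intro i j hij
  simpa using hij

/-- The arrival sequences that result when one online vertex `x` varies its stage. -/
theorem ArrivalOrder.exists_split {m : ℕ} {R : Type v} [Fintype R] [DecidableEq R]
    (A : ArrivalOrder m R) (s : R → Fin m) (x : R) :
    ∃ (σ : List R) (pre post : Fin m → List R), (∀ j, pre j ++ post j = σ) ∧
      (∀ i j, i ≤ j → pre i <+: pre j) ∧ (∀ j, ∀ z ∈ pre j, s z ≤ j) ∧ x ∉ σ ∧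
      ∀ j, List.ofFn (A.seq (Function.update s x j)) = pre j ++ x :: post j := by
  rcases Nat.eq_zero_or_pos m with rfl | hm
  · exact ⟨[], fun j => [], fun j => [], fun j => j.elim0, fun j => j.elim0, fun j => j.elim0,
      by simp, fun j => j.elim0⟩
  have hsplit : ∀ j, ∃ p q, List.ofFn (A.seq (Function.update s x j)) = p ++ x :: q := by
    intro j
    refine List.mem_iff_append.1 ?_
    rw [List.mem_ofFn]
    exact (A.seq _).surjective x
  choose pre post hsplit using hsplit
  have hpw : ∀ j, (pre j ++ x :: post j).Pairwise fun a b =>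
      (A.seq (Function.update s x j)).symm a < (A.seq (Function.update s x j)).symm b :=
    fun j => hsplit j ▸ A.pairwise_ofFn _
  have hnodup : ∀ j, (pre j ++ x :: post j).Nodup := fun j =>
    (hpw j).imp fun h => by rintro rfl; exact lt_irrefl _ h
  have hx : ∀ j, x ∉ pre j ++ post j := fun j =>
    (List.nodup_cons.1 ((List.perm_middle).nodup_iff.1 (hnodup j))).1
  have hmem : ∀ j z, z ≠ x → z ∈ pre j ++ post j := by
    intro j z hz
    have : z ∈ List.ofFn (A.seq (Function.update s x j)) := by
      rw [List.mem_ofFn]; exact (A.seq _).surjective z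
    rw [hsplit] at this
    simpa [hz] using this
  have hsub : ∀ j, (pre j ++ post j).Sublist (pre j ++ x :: post j) := fun j =>
    (List.Sublist.refl _).append (List.sublist_cons_self _ _)
  have hσ : ∀ i j, pre i ++ post i = pre j ++ post j := by
    intro i j
    have hne : ∀ i, ∀ z ∈ pre i ++ post i, z ≠ x := fun i z hz h => hx i (h ▸ hz)
    refine List.Perm.eq_of_pairwise (le := fun a b =>
      (A.seq (Function.update s x j)).symm a < (A.seq (Function.update s x j)).symm b)
      (fun a b _ _ h1 h2 => absurd h1 h2.not_gt) ?_ ((hpw j).sublist (hsub j)) ?_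
    · refine ((hpw i).sublist (hsub i)).imp_of_mem fun {a b} ha hb h => ?_
      exact (A.lt_iff_lt_update s x i j (hne i a ha) (hne i b hb)).1 h
    · rw [List.perm_ext_iff_of_nodup ((hnodup i).sublist (hsub i)) ((hnodup j).sublist (hsub j))]
      exact fun z => ⟨fun h => hmem j z (hne i z h), fun h => hmem i z (hne j z h)⟩
  have hle : ∀ j, ∀ z ∈ pre j, s z ≤ j := by
    intro j z hz
    have hzx : z ≠ x := fun h => hx j (h ▸ List.mem_append_left _ hz)
    by_contra! hlt
    have h1 := A.stage_lt (Function.update s x j) x z (by simpa [hzx] using hlt)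
    have h2 := (List.pairwise_append.1 (hpw j)).2.2 z hz x (by simp)
    exact h1.not_gt h2
  have hge : ∀ j, ∀ z ∈ post j, j ≤ s z := by
    intro j z hz
    have hzx : z ≠ x := fun h => hx j (h ▸ List.mem_append_right _ hz)
    by_contra! hlt
    have h1 := A.stage_lt (Function.update s x j) z x (by simpa [hzx] using hlt)
    have h2 := (List.pairwise_cons.1 (List.pairwise_append.1 (hpw j)).2.1).1 z hz
    exact h1.not_gt h2
  refine ⟨pre ⟨0, hm⟩ ++ post ⟨0, hm⟩, pre, post, fun j => hσ j _, ?_, hle, hx _, hsplit⟩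
  intro i j hij
  rcases hij.eq_or_lt with rfl | hij
  · exact List.prefix_rfl
  have h1 : pre i <+: pre j ++ post j := hσ i j ▸ List.prefix_append _ _
  rcases List.prefix_or_prefix_of_prefix h1 (List.prefix_append _ _) with h | ⟨t, ht⟩
  · exact h
  · cases t with
    | nil => rw [List.append_nil] at ht; exact ht ▸ List.prefix_rfl
    | cons z t =>
      have h2 := hσ i j
      rw [← ht, List.append_assoc] at h2
      have h3 : z ∈ post j := by rw [← List.append_cancel_left h2]; simp
      have h4 : z ∈ pre i := by rw [← ht]; simp
      exact absurd ((hge j z h3).trans (hle i z h4)) (not_le.2 hij)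

theorem sum_range_clamp (N : ℕ) {t : ℝ} (ht : 0 ≤ t) :
    ∑ i ∈ Finset.range N, max 0 (min 1 (t - i)) = min t N := by
  induction N with
  | zero => simp [ht]
  | succ N ih =>
    rw [Finset.sum_range_succ, ih]
    push_cast
    rcases le_total t N with h | h
    · rw [min_eq_left h, min_eq_right (a := 1) (by linarith), max_eq_left (by linarith),
        min_eq_left (by linarith), add_zero]
    · rw [min_eq_right h]
      rcases le_total t (N + 1) with h' | h'
      · rw [min_eq_left h', min_eq_right (a := 1) (by linarith),
          max_eq_right (by linarith)]; ring
      · rw [min_eq_right h', min_eq_left (a := 1) (by linarith),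
          max_eq_right (by norm_num)]

/-- The point in the `i`-th of the `n` cells of the unit interval whose relative position in the
cell is `z`. -/
def cellPoint (n : ℕ) (i : ℕ) (z : unitInterval) : unitInterval :=
  Set.projIcc 0 1 zero_le_one (((z : ℝ) + i) / n)

theorem coe_cellPoint {n i : ℕ} (hi : i < n) (z : unitInterval) :
    (cellPoint n i z : ℝ) = ((z : ℝ) + i) / n := by
  have hn : (0 : ℝ) < n := by exact_mod_cast (Nat.zero_le i).trans_lt hi
  have hi' : (i : ℝ) + 1 ≤ n := by exact_mod_cast hi
  rw [cellPoint, Set.projIcc_of_mem]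
  refine ⟨div_nonneg (add_nonneg z.2.1 (Nat.cast_nonneg i)) hn.le, ?_⟩
  rw [div_le_one hn]
  linarith [z.2.2]

theorem monotone_cellPoint (n : ℕ) (z : unitInterval) : Monotone fun i => cellPoint n i z := by
  intro i j hij
  refine Set.monotone_projIcc _ ?_
  have : (i : ℝ) ≤ j := by exact_mod_cast hij
  gcongr

theorem measurable_cellPoint (n i : ℕ) : Measurable (cellPoint n i) := by
  have : Continuous (cellPoint n i) := by
    unfold cellPoint
    refine continuous_projIcc.comp ?_
    fun_prop
  exact this.measurable

theorem floor_cellPoint {n i : ℕ} (hi : i < n) {z : unitInterval} (hz : z ≠ 1) :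
    ⌊(n : ℝ) * cellPoint n i z⌋₊ = i := by
  have hn : (0 : ℝ) < n := by exact_mod_cast (Nat.zero_le i).trans_lt hi
  rw [coe_cellPoint hi, mul_div_cancel₀ _ hn.ne',
    Nat.floor_eq_iff (add_nonneg z.2.1 (Nat.cast_nonneg i))]
  have h1 : (z : ℝ) < 1 := lt_of_le_of_ne z.2.2 fun h => hz (Subtype.ext h)
  have h0 := z.2.1
  constructor <;> linarith

theorem volume_preimage_cellPoint_Iic {n i : ℕ} (hi : i < n) (a : unitInterval) :
    volume (cellPoint n i ⁻¹' Set.Iic a) = ENNReal.ofReal (max 0 (min 1 (n * (a : ℝ) - i))) := by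
  have hn : (0 : ℝ) < n := by exact_mod_cast (Nat.zero_le i).trans_lt hi
  have hset : cellPoint n i ⁻¹' Set.Iic a = {z : unitInterval | (z : ℝ) ≤ n * a - i} := by
    ext z
    simp only [Set.mem_preimage, Set.mem_Iic, Set.mem_ofPred_eq]
    rw [← Subtype.coe_le_coe, coe_cellPoint hi, div_le_iff₀ hn]
    constructor <;> intro h <;> linarith
  rw [hset]
  rcases lt_or_ge (n * (a : ℝ) - i) 0 with h | h
  · rw [max_eq_left ((min_le_right _ _).trans h.le), ENNReal.ofReal_zero]
    convert measure_empty (μ := (volume : Measure unitInterval))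
    ext z
    simpa using h.trans_le z.2.1
  · have hmem : min 1 (n * (a : ℝ) - i) ∈ unitInterval := ⟨le_min zero_le_one h, min_le_left _ _⟩
    rw [max_eq_right hmem.1]
    convert unitInterval.volume_Iic (⟨_, hmem⟩ : unitInterval)
    ext z
    simp only [Set.mem_ofPred_eq, Set.mem_Iic, ← Subtype.coe_le_coe, le_min_iff]
    exact ⟨fun h => ⟨z.2.2, h⟩, fun h => h.2⟩

theorem sum_map_cellPoint {n : ℕ} :
    ∑ i ∈ Finset.range n, (volume : Measure unitInterval).map (cellPoint n i) =
      (n : ENNReal) • volume := by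
  have hfin : IsFiniteMeasure
      (∑ i ∈ Finset.range n, (volume : Measure unitInterval).map (cellPoint n i)) := by
    constructor
    rw [Measure.finsetSum_apply]
    exact ENNReal.sum_lt_top.2 fun i _ => measure_lt_top _ _
  refine Measure.ext_of_Iic _ _ fun a => ?_
  have h1 : ∀ i ∈ Finset.range n, (volume : Measure unitInterval).map (cellPoint n i) (Set.Iic a)
      = ENNReal.ofReal (max 0 (min 1 (n * (a : ℝ) - i))) := fun i hi => by
    rw [Measure.map_apply (measurable_cellPoint n i) measurableSet_Iic,
      volume_preimage_cellPoint_Iic (Finset.mem_range.1 hi)]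
  rw [Measure.finsetSum_apply, Finset.sum_congr rfl h1,
    ← ENNReal.ofReal_sum_of_nonneg (fun i _ => le_max_left _ _),
    sum_range_clamp n (mul_nonneg (Nat.cast_nonneg n) a.2.1), Measure.smul_apply,
    unitInterval.volume_Iic, smul_eq_mul,
    min_eq_left (mul_le_of_le_one_right (Nat.cast_nonneg n) a.2.2),
    ENNReal.ofReal_mul (Nat.cast_nonneg n), ENNReal.ofReal_natCast]

section Pi

variable {L : Type u} [DecidableEq L]

/-- Move the rank of `c` into the `i`-th of `n` cells. -/
def moveToCell (n : ℕ) (c : L) (i : ℕ) (y : L → unitInterval) : L → unitInterval :=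
  Function.update y c (cellPoint n i (y c))

theorem measurable_moveToCell (n : ℕ) (c : L) (i : ℕ) : Measurable (moveToCell n c i) := by
  refine measurable_pi_iff.2 fun a => ?_
  by_cases h : a = c
  · subst h
    simpa [moveToCell, Function.comp_def] using
      (measurable_cellPoint n i).comp (measurable_pi_apply a)
  · simpa [moveToCell, h] using measurable_pi_apply a

variable [Fintype L]

theorem sum_map_moveToCell {n : ℕ} (hn : 0 < n) (c : L) :
    ∑ i ∈ Finset.range n, (volume : Measure (L → unitInterval)).map (moveToCell n c i) =
      (n : ENNReal) • volume := by
  have hn0 : (n : ENNReal) ≠ 0 := by exact_mod_cast hn.ne'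
  have key : (volume : Measure (L → unitInterval)) = (n : ENNReal)⁻¹ •
      ∑ i ∈ Finset.range n, (volume : Measure (L → unitInterval)).map (moveToCell n c i) := by
    refine Measure.pi_eq fun B hB => ?_
    have h1 : ∀ i ∈ Finset.range n,
        (volume : Measure (L → unitInterval)).map (moveToCell n c i) (Set.univ.pi B) =
        (volume : Measure unitInterval).map (cellPoint n i) (B c) *
          ∏ a ∈ Finset.univ.erase c, volume (B a) := by
      intro i _
      rw [Measure.map_apply (measurable_moveToCell n c i) (MeasurableSet.univ_pi hB),
        Measure.map_apply (measurable_cellPoint n i) (hB c)]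
      have h2 : moveToCell n c i ⁻¹' Set.univ.pi B =
          Set.univ.pi (Function.update B c (cellPoint n i ⁻¹' B c)) := by
        ext y
        simp only [Set.mem_preimage, Set.mem_univ_pi, moveToCell]
        refine forall_congr' fun a => ?_
        by_cases h : a = c
        · subst h; simp
        · simp [h]
      rw [h2, volume_pi, Measure.pi_pi, ← Finset.mul_prod_erase _ _ (Finset.mem_univ c)]
      congr 1
      · simp
      · exact Finset.prod_congr rfl fun a ha => by simp [Finset.ne_of_mem_erase ha]
    rw [Measure.smul_apply, Measure.finsetSum_apply, Finset.sum_congr rfl h1, ← Finset.sum_mul,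
      ← Measure.finsetSum_apply, sum_map_cellPoint, Measure.smul_apply, smul_eq_mul, smul_eq_mul,
      ← mul_assoc, ← mul_assoc, ENNReal.inv_mul_cancel hn0 (ENNReal.natCast_ne_top n), one_mul,
      Finset.mul_prod_erase _ (fun a => volume (B a)) (Finset.mem_univ c)]
  conv_rhs => rw [key]
  rw [smul_smul, ENNReal.mul_inv_cancel hn0 (ENNReal.natCast_ne_top n), one_smul]

/-- To bound an integral over independent uniform ranks from below, it suffices to bound the
average over the `n` cells of one rank. -/
theorem le_integral_of_sum_moveToCell {n : ℕ} (hn : 0 < n) (c : L)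
    {H : (L → unitInterval) → ℝ} (hH : Measurable H) {B : ℝ} (hB : ∀ y, |H y| ≤ B) {C : ℝ}
    (h : ∀ y, y c ≠ 1 → C * n ≤ ∑ i ∈ Finset.range n, H (moveToCell n c i y)) :
    C ≤ ∫ y, H y := by
  have hint : ∀ (g : (L → unitInterval) → (L → unitInterval)), Measurable g →
      Integrable (fun y => H (g y)) := fun g hg =>
    Integrable.of_bound (hH.comp hg).aestronglyMeasurable B
      (Filter.Eventually.of_forall fun y => hB (g y))
  have h1 : ∑ i ∈ Finset.range n, ∫ y, H (moveToCell n c i y) = n * ∫ y, H y := by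
    have h2 : ∫ y, H y ∂((n : ENNReal) • (volume : Measure (L → unitInterval))) =
        n * ∫ y, H y := by
      rw [integral_smul_measure]; simp
    rw [← h2, ← sum_map_moveToCell hn c, integral_finsetSum_measure]
    · refine Finset.sum_congr rfl fun i _ => ?_
      rw [integral_map (measurable_moveToCell n c i).aemeasurable hH.aestronglyMeasurable]
    · intro i _
      exact (integrable_map_measure hH.aestronglyMeasurable
        (measurable_moveToCell n c i).aemeasurable).2 (hint _ (measurable_moveToCell n c i))
  have h3 : C * n ≤ n * ∫ y, H y := by
    rw [← h1, ← integral_finsetSum _ fun i _ => hint _ (measurable_moveToCell n c i)]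
    have h4 : C * n = ∫ _ : L → unitInterval, C * n := by simp
    rw [h4]
    refine integral_mono_ae (integrable_const _)
      (integrable_finsetSum _ fun i _ => hint _ (measurable_moveToCell n c i)) ?_
    filter_upwards [Measure.ae_eval_ne (fun _ : L => (volume : Measure unitInterval)) c 1]
      with y hy using h y hy
  have hn' : (0 : ℝ) < n := by exact_mod_cast hn
  rw [mul_comm] at h3
  exact le_of_mul_le_mul_left h3 hn'

end Pi

theorem IsPrice.measurable {m : ℕ} {f : Fin m → unitInterval → unitInterval} (hf : IsPrice f)
    (j : Fin m) : Measurable (f j) :=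
  (hf.monotone_rank j).measurable

/-- The utilities of an algorithm that is analysed with the price function `f`: the utility of an
offline vertex decreases with its rank, and a larger utility means a larger gain `w (1 - f)`. -/
structure IsUtility {L : Type u} {m : ℕ} (f : Fin m → unitInterval → unitInterval) (w : L → ℝ)
    (V : Fin m → L → unitInterval → ℝ) : Prop where
  antitone : ∀ j a, Antitone (V j a)
  gain_le : ∀ j a b y y', V j b y' ≤ V j a y →
    w b * (1 - (f j y' : ℝ)) ≤ w a * (1 - (f j y : ℝ))

/-- The utility of `a` for the online vertex `x` when it depends on the stage of `x` and the rank
of `a`. -/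
def stageUtil {L : Type u} {R : Type v} {m : ℕ} (V : Fin m → L → unitInterval → ℝ)
    (s : R → Fin m) (y : L → unitInterval) (x : R) (a : L) : ℝ :=
  V (s x) a (y a)

theorem matchingWeight_le {L : Type u} {R : Type v} [Fintype L] [Fintype R] {w : L → ℝ}
    (hw : ∀ a, 0 ≤ w a) (M : Finset (L × R)) :
    matchingWeight w M ≤ ∑ p : L × R, w p.1 :=
  Finset.sum_le_sum_of_subset_of_nonneg (Finset.subset_univ _) fun p _ _ => hw p.1

theorem matchingWeight_nonneg {L : Type u} {R : Type v} {w : L → ℝ}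
    (hw : ∀ a, 0 ≤ w a) (M : Finset (L × R)) : 0 ≤ matchingWeight w M :=
  Finset.sum_nonneg fun p _ => hw p.1

section Gain

variable {L : Type u} {R : Type v} {m : ℕ}
  (f : Fin m → unitInterval → unitInterval) (w : L → ℝ) (s : R → Fin m) (y : L → unitInterval)
  (M : Finset (L × R))

open Classical in
/-- The share of the offline vertex `c` in the weight of `M`. -/
def offlineGain (c : L) : ℝ :=
  ∑ p ∈ M, if p.1 = c then w p.1 * (f (s p.2) (y p.1) : ℝ) else 0

open Classical in
/-- The share of the online vertex `x` in the weight of `M`. -/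
def onlineGain (x : R) : ℝ :=
  ∑ p ∈ M, if p.2 = x then w p.1 * (1 - (f (s p.2) (y p.1) : ℝ)) else 0

variable {f w s y M} (hw : ∀ a, 0 ≤ w a)
include hw

theorem offlineGain_term_nonneg (p : L × R) : 0 ≤ w p.1 * (f (s p.2) (y p.1) : ℝ) :=
  mul_nonneg (hw _) (f _ _).2.1

theorem onlineGain_term_nonneg (p : L × R) : 0 ≤ w p.1 * (1 - (f (s p.2) (y p.1) : ℝ)) :=
  mul_nonneg (hw _) (sub_nonneg.2 (f _ _).2.2)

theorem offlineGain_nonneg (c : L) : 0 ≤ offlineGain f w s y M c :=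
  Finset.sum_nonneg fun p _ => by
    split_ifs
    exacts [offlineGain_term_nonneg hw p, le_rfl]

theorem onlineGain_nonneg (x : R) : 0 ≤ onlineGain f w s y M x :=
  Finset.sum_nonneg fun p _ => by
    split_ifs
    exacts [onlineGain_term_nonneg hw p, le_rfl]

theorem le_offlineGain {p : L × R} (hp : p ∈ M) :
    w p.1 * (f (s p.2) (y p.1) : ℝ) ≤ offlineGain f w s y M p.1 := by
  classical
  refine le_trans ?_ (Finset.single_le_sum (fun q _ => ?_) hp)
  · simp
  · split_ifs
    exacts [offlineGain_term_nonneg hw q, le_rfl]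

theorem le_onlineGain {p : L × R} (hp : p ∈ M) :
    w p.1 * (1 - (f (s p.2) (y p.1) : ℝ)) ≤ onlineGain f w s y M p.2 := by
  classical
  refine le_trans ?_ (Finset.single_le_sum (fun q _ => ?_) hp)
  · simp
  · split_ifs
    exacts [onlineGain_term_nonneg hw q, le_rfl]

theorem offlineGain_le (c : L) : offlineGain f w s y M c ≤ matchingWeight w M :=
  Finset.sum_le_sum fun p _ => by
    split_ifs
    exacts [mul_le_of_le_one_right (hw _) (f _ _).2.2, hw _]

theorem onlineGain_le (x : R) : onlineGain f w s y M x ≤ matchingWeight w M :=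
  Finset.sum_le_sum fun p _ => by
    split_ifs
    exacts [mul_le_of_le_one_right (hw _) (by linarith [(f (s p.2) (y p.1)).2.1]), hw _]

/-- The shares of the vertices covered by any matching add up to at most the weight of `M`. -/
theorem sum_gain_le {E : L → R → Prop} {M' : Finset (L × R)} (hM' : IsMatching E M') :
    ∑ q ∈ M', (offlineGain f w s y M q.1 + onlineGain f w s y M q.2) ≤ matchingWeight w M := by
  classical
  have once : ∀ (P : L × R → Prop) (A : ℝ), 0 ≤ A →
      (∀ p ∈ M', ∀ q ∈ M', P p → P q → p = q) → ∑ q ∈ M', (if P q then A else 0) ≤ A := by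
    intro P A hA hinj
    rw [← Finset.sum_filter, Finset.sum_const, nsmul_eq_mul]
    refine mul_le_of_le_one_left hA ?_
    have : (M'.filter P).card ≤ 1 := by
      rw [Finset.card_le_one]
      intro p hp q hq
      rw [Finset.mem_filter] at hp hq
      exact hinj p hp.1 q hq.1 hp.2 hq.2
    exact_mod_cast this
  rw [Finset.sum_add_distrib]
  simp only [offlineGain, onlineGain]
  rw [Finset.sum_comm, Finset.sum_comm (s := M') (t := M), ← Finset.sum_add_distrib]
  refine Finset.sum_le_sum fun p _ => ?_
  have h1 := once (fun q => p.1 = q.1) _ (offlineGain_term_nonneg (f := f) (s := s) (y := y) hw p)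
    fun q hq q' hq' h h' => hM'.offline q hq q' hq' (h.symm.trans h')
  have h2 := once (fun q => p.2 = q.2) _ (onlineGain_term_nonneg (f := f) (s := s) (y := y) hw p)
    fun q hq q' hq' h h' => hM'.online q hq q' hq' (h.symm.trans h')
  calc _ ≤ _ := add_le_add h1 h2
    _ = w p.1 := by ring

end Gain

section Measurability

variable {L : Type u} {R : Type v} [Fintype L] [LinearOrder L] [Fintype R] {m : ℕ}

theorem measurable_comp_run (E : L → R → Prop) {V : Fin m → L → unitInterval → ℝ}
    (hV : ∀ j a, Antitone (V j a)) (s : R → Fin m) (seq : Fin (Fintype.card R) ≃ R)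
    (Ψ : Finset (L × R) → ℝ) :
    Measurable fun y : L → unitInterval => Ψ (run E (stageUtil V s y) seq) := by
  set pattern : (L → unitInterval) → R → L → L → Prop := fun y x a b =>
    stageUtil V s y x a ≤ stageUtil V s y x b with hpat
  have hmeas : Measurable pattern := by
    refine measurable_pi_iff.2 fun x => measurable_pi_iff.2 fun a => measurable_pi_iff.2 fun b => ?_
    refine measurableSet_setOfPred.1 (measurableSet_le ?_ ?_)
    · exact (hV (s x) a).measurable.comp (measurable_pi_apply a)
    · exact (hV (s x) b).measurable.comp (measurable_pi_apply b)
  set g : (L → unitInterval) → ℝ := fun y => Ψ (run E (stageUtil V s y) seq)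
  have hfac : g.FactorsThrough pattern := by
    intro y y' h
    have : run E (stageUtil V s y) seq = run E (stageUtil V s y') seq :=
      foldl_step_congr E _ _ fun x _ a b =>
        iff_of_eq (congrFun (congrFun (congrFun h x) a) b)
    simp only [g, this]
  have : g = Function.extend pattern g 0 ∘ pattern := by
    funext y
    exact (hfac.extend_apply 0 y).symm
  rw [this]
  exact (Measurable.of_discrete).comp hmeas

variable (E : L → R → Prop) (w : L → ℝ) {V : Fin m → L → unitInterval → ℝ}
  (hV : ∀ j a, Antitone (V j a)) (s : R → Fin m) (seq : Fin (Fintype.card R) ≃ R)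
  {f : Fin m → unitInterval → unitInterval}
include hV

theorem measurable_sum_run {g : L × R → (L → unitInterval) → ℝ} (hg : ∀ p, Measurable (g p)) :
    Measurable fun y => ∑ p ∈ run E (stageUtil V s y) seq, g p y := by
  classical
  have h : ∀ y, ∑ p ∈ run E (stageUtil V s y) seq, g p y =
      ∑ p, (if p ∈ run E (stageUtil V s y) seq then (1 : ℝ) else 0) * g p y := fun y => by
    simp
  simp only [h]
  refine Finset.measurable_sum _ fun p _ => Measurable.mul ?_ (hg p)
  exact measurable_comp_run E hV s seq fun M => if p ∈ M then (1 : ℝ) else 0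

theorem measurable_offlineGain (hf : IsPrice f) (c : L) :
    Measurable fun y => offlineGain f w s y (run E (stageUtil V s y) seq) c := by
  unfold offlineGain
  refine measurable_sum_run E hV s seq fun p => ?_
  have := (measurable_subtype_coe.comp (hf.measurable (s p.2))).comp
    (measurable_pi_apply (X := fun _ : L => unitInterval) p.1)
  split_ifs
  · exact measurable_const.mul this
  · exact measurable_const

theorem measurable_onlineGain (hf : IsPrice f) (x : R) :
    Measurable fun y => onlineGain f w s y (run E (stageUtil V s y) seq) x := by
  unfold onlineGain
  refine measurable_sum_run E hV s seq fun p => ?_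
  have := (measurable_subtype_coe.comp (hf.measurable (s p.2))).comp
    (measurable_pi_apply (X := fun _ : L => unitInterval) p.1)
  split_ifs
  · exact measurable_const.mul (measurable_const.sub this)
  · exact measurable_const

end Measurability

theorem sum_sum_update {R : Type v} [Fintype R] [DecidableEq R] {m : ℕ} (x : R)
    (g : (R → Fin m) → ℝ) :
    ∑ s, ∑ j, g (Function.update s x j) = m * ∑ s, g s := by
  have h : ∑ p : (R → Fin m) × Fin m, g (Function.update p.1 x p.2) =
      ∑ p : (R → Fin m) × Fin m, g p.1 := by
    refine Fintype.sum_equiv (Function.Involutive.toPerm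
      (fun p : (R → Fin m) × Fin m => (Function.update p.1 x p.2, p.1 x)) ?_) _ _ fun p => rfl
    rintro ⟨s, j⟩
    simp
  rw [Fintype.sum_prod_type, Fintype.sum_prod_type] at h
  rw [h, Finset.mul_sum]
  exact Finset.sum_congr rfl fun s _ => by simp

/-- A table of prices for `m` stages and `n` levels of ranks, in multiples of `1 / Q`. -/
structure IsPriceTable {m : ℕ} (n Q : ℕ) (F : Fin m → ℕ → ℕ) : Prop where
  antitone_stage : ∀ k ≤ n, Antitone fun j => F j k
  monotone_level : ∀ j k k', k ≤ k' → k' ≤ n → F j k ≤ F j k'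
  top : ∀ j, F j n = Q
  level_pos : 0 < n
  scale_pos : 0 < Q

/-- The price function that is constant on each of `n` cells of ranks. -/
def tablePrice {m : ℕ} (n Q : ℕ) (F : Fin m → ℕ → ℕ) (j : Fin m) (y : unitInterval) :
    unitInterval :=
  Set.projIcc 0 1 zero_le_one ((F j ⌊(n : ℝ) * y⌋₊ : ℝ) / Q)

theorem floor_mul_le (n : ℕ) (y : unitInterval) : ⌊(n : ℝ) * y⌋₊ ≤ n :=
  Nat.floor_le_of_le (mul_le_of_le_one_right (Nat.cast_nonneg n) y.2.2)

namespace IsPriceTable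

variable {m n Q : ℕ} {F : Fin m → ℕ → ℕ} (hF : IsPriceTable n Q F)
include hF

theorem scale_pos' : (0 : ℝ) < Q := by exact_mod_cast hF.scale_pos

theorem div_mem (j : Fin m) {k : ℕ} (hk : k ≤ n) : (F j k : ℝ) / Q ∈ Set.Icc (0 : ℝ) 1 := by
  refine ⟨by positivity, ?_⟩
  rw [div_le_one hF.scale_pos']
  exact_mod_cast (hF.monotone_level j k n hk le_rfl).trans_eq (hF.top j)

theorem coe_tablePrice_of_floor {j : Fin m} {y : unitInterval} {k : ℕ} (hk : k ≤ n)
    (h : ⌊(n : ℝ) * y⌋₊ = k) : (tablePrice n Q F j y : ℝ) = F j k / Q := by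
  rw [tablePrice, h, Set.projIcc_of_mem _ (hF.div_mem j hk)]

theorem isPrice : IsPrice (tablePrice n Q F) where
  antitone_stage y i j hij := by
    refine Set.monotone_projIcc _ ?_
    have : (F j ⌊(n : ℝ) * y⌋₊ : ℝ) ≤ F i ⌊(n : ℝ) * y⌋₊ := by
      exact_mod_cast hF.antitone_stage _ (floor_mul_le n y) hij
    gcongr
  monotone_rank j y y' hy := by
    refine Set.monotone_projIcc _ ?_
    have h1 : ⌊(n : ℝ) * y⌋₊ ≤ ⌊(n : ℝ) * y'⌋₊ := Nat.floor_mono (by gcongr)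
    have : (F j ⌊(n : ℝ) * y⌋₊ : ℝ) ≤ F j ⌊(n : ℝ) * y'⌋₊ := by
      exact_mod_cast hF.monotone_level j _ _ h1 (floor_mul_le n y')
    gcongr
  one j := by
    refine Subtype.ext ?_
    rw [hF.coe_tablePrice_of_floor le_rfl (by simp), hF.top j]
    exact div_self hF.scale_pos'.ne'

end IsPriceTable

/-- The numerical condition on a price table that yields the competitive ratio `ρ`: here `β j` and
`θ j` are the thresholds of `exists_thresholds`, and `G` bounds the share of the offline
vertex. -/
def IsRatio {m : ℕ} (n Q : ℕ) (F : Fin m → ℕ → ℕ) (ρ : ℝ) : Prop :=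
  ∀ β θ : Fin m → ℕ, Monotone β → (∀ j, β j ≤ θ j ∧ θ j ≤ n) → ∃ G : ℕ → ℕ,
    (∀ k < n, G k = 0 ∨ ∃ i, k < β i ∧ G k ≤ F i k) ∧
    ρ * (m * n * Q) ≤ ∑ j, ∑ k ∈ Finset.range n,
      (if β j ≤ k ∧ k < θ j then (Q : ℝ) else Q - F j (θ j) + G k)

section Core

variable {L : Type u} {R : Type v} [Fintype L] [LinearOrder L] [Fintype R] [DecidableEq R]
  {m n Q : ℕ} {F : Fin m → ℕ → ℕ} {ρ : ℝ}

/-- The expected share of an edge, when the stage of its online vertex and the level of its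
offline vertex vary. -/
theorem le_sum_gain (hF : IsPriceTable n Q F) (hρ : IsRatio n Q F ρ) (A : ArrivalOrder m R)
    (E : L → R → Prop) {w : L → ℝ} (hw : ∀ a, 0 ≤ w a) {V : Fin m → L → unitInterval → ℝ}
    (hV : IsUtility (tablePrice n Q F) w V) {c : L} {x : R} (hE : E c x) (s : R → Fin m)
    {y : L → unitInterval} (hy : y c ≠ 1) :
    ρ * (m * n) * w c ≤ ∑ j, ∑ k ∈ Finset.range n,
      (offlineGain (tablePrice n Q F) w (Function.update s x j) (moveToCell n c k y)
          (run E (stageUtil V (Function.update s x j) (moveToCell n c k y))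
            (A.seq (Function.update s x j))) c +
        onlineGain (tablePrice n Q F) w (Function.update s x j) (moveToCell n c k y)
          (run E (stageUtil V (Function.update s x j) (moveToCell n c k y))
            (A.seq (Function.update s x j))) x) := by
  obtain ⟨σ, pre, post, hσ, hpre, hstage, hxσ, hseq⟩ := A.exists_split s x
  have hmove : ∀ k a, a ≠ c → moveToCell n c k y a = y a := fun k a ha => by
    simp [moveToCell, ha]
  have hmovec : ∀ k, moveToCell n c k y c = cellPoint n k (y c) := fun k => by
    simp [moveToCell]
  have hprice : ∀ j k, k < n →
      (tablePrice n Q F j (moveToCell n c k y c) : ℝ) = F j k / Q := fun j k hk => by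
    rw [hmovec]
    exact hF.coe_tablePrice_of_floor hk.le (floor_cellPoint hk hy)
  have hpne : ∀ j, ∀ z ∈ pre j, z ≠ x := fun j z hz h =>
    hxσ (hσ j ▸ h ▸ List.mem_append_left _ hz)
  have hqne : ∀ j, ∀ z ∈ post j, z ≠ x := fun j z hz h =>
    hxσ (hσ j ▸ h ▸ List.mem_append_right _ hz)
  obtain ⟨β, θ, hβ, hθ, hthr⟩ := exists_thresholds E
    (fun k z a => V (s z) a (moveToCell n c k y a))
    (fun j k _ a => V j a (moveToCell n c k y a)) hE n
    (fun k k' z a ha => by simp only [hmove _ a ha])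
    (fun k k' z hk => by
      simp only [hmovec]; exact hV.antitone _ _ (monotone_cellPoint n (y c) hk))
    (fun j k k' z a ha => by simp only [hmove _ a ha])
    (fun j k k' z hk => by
      simp only [hmovec]; exact hV.antitone _ _ (monotone_cellPoint n (y c) hk))
    σ pre post hσ hpre
    (fun j k => run E (stageUtil V (Function.update s x j) (moveToCell n c k y))
            (A.seq (Function.update s x j)))
    (fun j k => by
      simp only [run, hseq, List.foldl_append, List.foldl_cons]
      rw [foldl_step_congr E (pre j) ∅ (util' := fun z a => V (s z) a (moveToCell n c k y a))
        fun z hz a b => by simp [stageUtil, hpne j z hz]]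
      rw [step_congr E _ (x := x) (util' := fun _ a => V j a (moveToCell n c k y a))
        fun a b => by simp [stageUtil]]
      exact foldl_step_congr E (post j) _ fun z hz a b => by simp [stageUtil, hqne j z hz])
  obtain ⟨G, hG, hsum⟩ := hρ β θ hβ hθ
  have hQ := hF.scale_pos'
  have hmain : ∑ j, ∑ k ∈ Finset.range n,
      (w c / Q) * (if β j ≤ k ∧ k < θ j then (Q : ℝ) else Q - F j (θ j) + G k) ≤
      ∑ j, ∑ k ∈ Finset.range n,
      (offlineGain (tablePrice n Q F) w (Function.update s x j) (moveToCell n c k y)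
          (run E (stageUtil V (Function.update s x j) (moveToCell n c k y))
            (A.seq (Function.update s x j))) c +
        onlineGain (tablePrice n Q F) w (Function.update s x j) (moveToCell n c k y)
          (run E (stageUtil V (Function.update s x j) (moveToCell n c k y))
            (A.seq (Function.update s x j))) x) := by
    refine Finset.sum_le_sum fun j _ => Finset.sum_le_sum fun k hk => ?_
    rw [Finset.mem_range] at hk
    obtain ⟨h1, h2, h3⟩ := hthr j k hk
    have hwc := hw c
    split_ifs with hin
    · have hmem := h1 hin.1 hin.2
      have ha := le_offlineGain (f := tablePrice n Q F) (s := Function.update s x j)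
        (y := moveToCell n c k y) hw hmem
      have hb := le_onlineGain (f := tablePrice n Q F) (s := Function.update s x j)
        (y := moveToCell n c k y) hw hmem
      rw [div_mul_cancel₀ _ hQ.ne']
      refine le_trans (le_of_eq ?_) (add_le_add ha hb)
      ring
    · have honl : (w c / Q) * ((Q : ℝ) - F j (θ j)) ≤
          onlineGain (tablePrice n Q F) w (Function.update s x j) (moveToCell n c k y)
          (run E (stageUtil V (Function.update s x j) (moveToCell n c k y))
            (A.seq (Function.update s x j))) x := by
        rcases (hθ j).2.lt_or_eq with hlt | heq
        · obtain ⟨b, hbc, hmem, hle⟩ := h2 hin hlt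
          have hb := le_onlineGain (f := tablePrice n Q F) (s := Function.update s x j)
            (y := moveToCell n c k y) hw hmem
          refine le_trans ?_ hb
          have hg := hV.gain_le j b c _ _ hle
          simp only [hmove _ b hbc, Function.update_self] at hg ⊢
          rw [hprice j _ hlt] at hg
          refine le_trans (le_of_eq ?_) hg
          field_simp
        · rw [heq, hF.top, sub_self, mul_zero]
          exact onlineGain_nonneg hw x
      have hoff : (w c / Q) * (G k : ℝ) ≤
          offlineGain (tablePrice n Q F) w (Function.update s x j) (moveToCell n c k y)
          (run E (stageUtil V (Function.update s x j) (moveToCell n c k y))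
            (A.seq (Function.update s x j))) c := by
        rcases hG k hk with h0 | ⟨i, hki, hGi⟩
        · rw [h0, Nat.cast_zero, mul_zero]
          exact offlineGain_nonneg hw c
        · obtain ⟨z, hmem, hz⟩ := h3 i hki
          have ha := le_offlineGain (f := tablePrice n Q F) (s := Function.update s x j)
            (y := moveToCell n c k y) hw hmem
          refine le_trans ?_ ha
          have hzi : Function.update s x j z ≤ i := by
            rcases hz with hz | ⟨rfl, hz⟩
            · simpa [hpne i z hz] using hstage i z hz
            · simpa using hz
          have hf : (F i k : ℝ) / Q ≤
              tablePrice n Q F (Function.update s x j z) (moveToCell n c k y c) := by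
            rw [← hprice i k hk]
            exact hF.isPrice.antitone_stage _ hzi
          have hG' : (G k : ℝ) ≤ F i k := by exact_mod_cast hGi
          calc w c / Q * (G k : ℝ) ≤ w c / Q * F i k := by gcongr
            _ = w c * (F i k / Q) := by ring
            _ ≤ _ := by gcongr
      calc _ = (w c / Q) * (G k : ℝ) + (w c / Q) * ((Q : ℝ) - F j (θ j)) := by ring
        _ ≤ _ := add_le_add hoff honl
  refine le_trans ?_ hmain
  simp only [← Finset.mul_sum]
  calc ρ * (m * n) * w c = w c / Q * (ρ * (m * n * Q)) := by field_simp
    _ ≤ _ := by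
      have := hw c
      gcongr

theorem le_expectedWeight (hm : 0 < m) (hF : IsPriceTable n Q F) (hρ : IsRatio n Q F ρ)
    (A : ArrivalOrder m R) (E : L → R → Prop) {w : L → ℝ} (hw : ∀ a, 0 ≤ w a)
    {V : Fin m → L → unitInterval → ℝ} (hV : IsUtility (tablePrice n Q F) w V) :
    ρ * opt E w ≤ expectedWeight A E w (stageUtil V) := by
  classical
  set f := tablePrice n Q F with hf
  have hfp : IsPrice f := hF.isPrice
  set N : ℝ := ((Fintype.card (R → Fin m) : ℕ) : ℝ) with hN
  have hNpos : 0 < N := by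
    have : Nonempty (Fin m) := ⟨⟨0, hm⟩⟩
    rw [hN]; exact_mod_cast Fintype.card_pos
  obtain ⟨M', hM', hopt⟩ := Finset.exists_mem_eq_sup' (s := Finset.univ.filter
    fun M : Finset (L × R) => IsMatching E M) ⟨∅, by simpa using isMatching_empty E⟩
    (matchingWeight w)
  have hM'' : IsMatching E M' := by simpa using hM'
  have hopt' : opt E w = matchingWeight w M' := by rw [← hopt, opt]
  set B : ℝ := ∑ p : L × R, w p.1
  let gain : L × R → (R → Fin m) → (L → unitInterval) → ℝ := fun q s y =>
    offlineGain f w s y (run E (stageUtil V s y) (A.seq s)) q.1 +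
      onlineGain f w s y (run E (stageUtil V s y) (A.seq s)) q.2
  have hgm : ∀ q s, Measurable (gain q s) := fun q s =>
    (measurable_offlineGain E w hV.antitone s _ hfp q.1).add
      (measurable_onlineGain E w hV.antitone s _ hfp q.2)
  have hg0 : ∀ q s y, 0 ≤ gain q s y := fun q s y =>
    add_nonneg (offlineGain_nonneg hw _) (onlineGain_nonneg hw _)
  have hgB : ∀ q s y, gain q s y ≤ B + B := fun q s y =>
    add_le_add ((offlineGain_le hw _).trans (matchingWeight_le hw _))
      ((onlineGain_le hw _).trans (matchingWeight_le hw _))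
  have hHm : ∀ q, Measurable fun y => ∑ s, gain q s y := fun q =>
    Finset.measurable_sum _ fun s _ => hgm q s
  have hHB : ∀ q y, |∑ s, gain q s y| ≤ ∑ _s : R → Fin m, (B + B) := fun q y => by
    rw [abs_of_nonneg (Finset.sum_nonneg fun s _ => hg0 q s y)]
    exact Finset.sum_le_sum fun s _ => hgB q s y
  have hedge : ∀ q ∈ M', ρ * N * w q.1 ≤ ∫ y, ∑ s, gain q s y := by
    intro q hq
    refine le_integral_of_sum_moveToCell hF.level_pos q.1 (hHm q) (hHB q) fun y hy => ?_
    have h1 : ∑ s : R → Fin m, ρ * (m * n) * w q.1 ≤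
        ∑ s : R → Fin m, ∑ j, ∑ k ∈ Finset.range n,
          gain q (Function.update s q.2 j) (moveToCell n q.1 k y) :=
      Finset.sum_le_sum fun s _ => le_sum_gain hF hρ A E hw hV (hM''.edge q hq) s hy
    rw [sum_sum_update q.2 (fun s => ∑ k ∈ Finset.range n, gain q s (moveToCell n q.1 k y)),
      Finset.sum_comm, Finset.sum_const, Finset.card_univ, nsmul_eq_mul, ← hN] at h1
    have hm' : (0 : ℝ) < m := by exact_mod_cast hm
    refine le_of_mul_le_mul_left ?_ hm'
    calc (m : ℝ) * (ρ * N * w q.1 * n) = N * (ρ * (m * n) * w q.1) := by ring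
      _ ≤ _ := h1
  have hmw : ∀ s, Integrable fun y : L → unitInterval =>
      matchingWeight w (run E (stageUtil V s y) (A.seq s)) := fun s =>
    Integrable.of_bound
      (measurable_comp_run E hV.antitone s (A.seq s) (matchingWeight w)).aestronglyMeasurable B
      (Filter.Eventually.of_forall fun y => by
        rw [Real.norm_of_nonneg (matchingWeight_nonneg hw _)]
        exact matchingWeight_le hw _)
  have hHint : ∀ q, Integrable fun y => ∑ s, gain q s y := fun q =>
    Integrable.of_bound (hHm q).aestronglyMeasurable _
      (Filter.Eventually.of_forall fun y => hHB q y)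
  rw [expectedWeight, le_div_iff₀ hNpos, ← integral_finsetSum _ fun s _ => hmw s]
  calc ρ * opt E w * N = ∑ q ∈ M', ρ * N * w q.1 := by
        rw [hopt', matchingWeight, ← Finset.mul_sum]; ring
    _ ≤ ∑ q ∈ M', ∫ y, ∑ s, gain q s y := Finset.sum_le_sum hedge
    _ = ∫ y, ∑ q ∈ M', ∑ s, gain q s y := (integral_finsetSum _ fun q _ => hHint q).symm
    _ ≤ ∫ y, ∑ s, matchingWeight w (run E (stageUtil V s y) (A.seq s)) := by
        refine integral_mono (integrable_finsetSum _ fun q _ => hHint q)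
          (integrable_finsetSum _ fun s _ => hmw s) fun y => ?_
        simp only
        rw [Finset.sum_comm]
        exact Finset.sum_le_sum fun s _ => sum_gain_le hw hM''

end Core

theorem IsPriceTable.weightedCompetitive {m n Q : ℕ} {F : Fin m → ℕ → ℕ} {ρ : ℝ} (hm : 0 < m)
    (hF : IsPriceTable n Q F) (hρ : IsRatio n Q F ρ) :
    WeightedCompetitive.{u, v} m (tablePrice n Q F) ρ := by
  intro L R _ _ _ _ E w A hw
  refine le_expectedWeight (V := fun j a y => w a * (1 - (tablePrice n Q F j y : ℝ))) hm hF hρ A E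
    hw ⟨fun j a y y' hy => ?_, fun j a b y y' h => h⟩
  have h1 : (tablePrice n Q F j y : ℝ) ≤ tablePrice n Q F j y' := hF.isPrice.monotone_rank j hy
  have := hw a
  gcongr

theorem IsPriceTable.classicalCompetitive {m n Q : ℕ} {F : Fin m → ℕ → ℕ} {ρ : ℝ} (hm : 0 < m)
    (hF : IsPriceTable n Q F) (hρ : IsRatio n Q F ρ) : ClassicalCompetitive.{u, v} m ρ := by
  intro L R _ _ _ _ E A
  refine le_expectedWeight (V := fun _ _ y => -(y : ℝ)) hm hF hρ A E
    (fun _ => zero_le_one) ⟨fun j a y y' hy => neg_le_neg (by exact_mod_cast hy),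
      fun j a b y y' h => ?_⟩
  have h1 : y ≤ y' := by exact_mod_cast neg_le_neg_iff.1 h
  have h2 : (tablePrice n Q F j y : ℝ) ≤ tablePrice n Q F j y' := hF.isPrice.monotone_rank j h1
  linarith

theorem monotone_of_le_succ {n : ℕ} {g : ℕ → ℕ} (h : ∀ k < n, g k ≤ g (k + 1)) {k k' : ℕ}
    (hk : k ≤ k') (hk' : k' ≤ n) : g k ≤ g k' := by
  induction k', hk using Nat.le_induction with
  | base => exact le_rfl
  | succ i hi ih => exact (ih (by omega)).trans (h i (by omega))

theorem sum_range_eq_of_succ {n : ℕ} {p f : ℕ → ℕ} (h0 : p 0 = 0)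
    (h : ∀ k < n, p (k + 1) = p k + f k) {k : ℕ} (hk : k ≤ n) :
    ∑ i ∈ Finset.range k, (f i : ℝ) = p k := by
  induction k with
  | zero => simp [h0]
  | succ k ih => rw [Finset.sum_range_succ, ih (by omega), h k (by omega), Nat.cast_add]

theorem sum_range_ite_lt (x b : ℕ) (g : ℕ → ℝ) :
    ∑ k ∈ Finset.range x, (if k < b then g k else 0) = ∑ k ∈ Finset.range (min x b), g k := by
  rw [← Finset.sum_filter]
  congr 1
  ext k
  simp

theorem sum_range_ite_mem {n b t : ℕ} (hbt : b ≤ t) (htn : t ≤ n) (Q q : ℝ) (G : ℕ → ℝ) :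
    ∑ k ∈ Finset.range n, (if b ≤ k ∧ k < t then Q else Q - q + G k) =
      n * Q - q * ((n - t + b : ℕ) : ℝ) + ∑ k ∈ Finset.range n, G k -
        ∑ k ∈ Finset.range t, G k + ∑ k ∈ Finset.range b, G k := by
  have h1 : ∀ k, (if b ≤ k ∧ k < t then Q else Q - q + G k) =
      (Q - q + G k) + (if k < t then q - G k else 0) - (if k < b then q - G k else 0) := by
    intro k
    split_ifs <;> first | omega | ring
  simp only [h1]
  rw [Finset.sum_sub_distrib, Finset.sum_add_distrib, sum_range_ite_lt, sum_range_ite_lt,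
    min_eq_right htn, min_eq_right (hbt.trans htn)]
  simp only [Finset.sum_add_distrib, Finset.sum_sub_distrib, Finset.sum_const, Finset.card_range,
    nsmul_eq_mul]
  push_cast [htn]
  ring

theorem min_comp_of_monotone {n : ℕ} {p : ℕ → ℕ} (hp : ∀ k k', k ≤ k' → k' ≤ n → p k ≤ p k')
    {a b : ℕ} (ha : a ≤ n) (hb : b ≤ n) : p (min a b) = min (p a) (p b) := by
  rcases le_total a b with h | h
  · rw [min_eq_left h, min_eq_left (hp a b h hb)]
  · rw [min_eq_right h, min_eq_right (hp b a h ha)]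

theorem isRatio_two {n Q : ℕ} {ρ : ℝ} {f₀ f₁ p₀ p₁ N : ℕ → ℕ} {O K : ℕ}
    (hp₀ : ∀ k ≤ n, ∑ i ∈ Finset.range k, (f₀ i : ℝ) = p₀ k)
    (hp₁ : ∀ k ≤ n, ∑ i ∈ Finset.range k, (f₁ i : ℝ) = p₁ k)
    (hmono : ∀ k k', k ≤ k' → k' ≤ n → p₁ k ≤ p₁ k')
    (hN : ∀ r t, r ≤ t → t ≤ n → f₁ t * (n - t + r) + O ≤ N r + 2 * p₁ r)
    (hK : ∀ b t r, b ≤ t → b ≤ r → t ≤ n → r ≤ n →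
      f₀ t * (n - t + b) + N r + min (p₁ t) (p₁ r) + p₁ b ≤ K + 2 * p₀ b)
    (hρ : ρ * (2 * n * Q) + K ≤ 2 * n * Q + O) :
    IsRatio n Q ![f₀, f₁] ρ := by
  intro β θ hβ hθ
  obtain ⟨h0, h0n⟩ := hθ 0
  obtain ⟨h1, h1n⟩ := hθ 1
  have h01 : β 0 ≤ β 1 := hβ (by decide)
  set b₀ := β 0
  set b₁ := β 1
  set t₀ := θ 0
  set t₁ := θ 1
  set G : ℕ → ℕ := fun k => if k < b₀ then f₀ k else if k < b₁ then f₁ k else 0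
  refine ⟨G, fun k _ => ?_, ?_⟩
  · simp only [G]
    split_ifs with h h'
    · exact Or.inr ⟨0, h, le_rfl⟩
    · exact Or.inr ⟨1, h', le_rfl⟩
    · exact Or.inl rfl
  have hG : ∀ k, (G k : ℝ) =
      (if k < b₀ then (f₀ k : ℝ) - f₁ k else 0) + (if k < b₁ then (f₁ k : ℝ) else 0) := by
    intro k
    simp only [G]
    split_ifs <;> first | omega | simp
  have hsum : ∀ x ≤ n, ∑ k ∈ Finset.range x, (G k : ℝ) =
      p₀ (min x b₀) - p₁ (min x b₀) + p₁ (min x b₁) := by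
    intro x hx
    simp only [hG]
    rw [Finset.sum_add_distrib, sum_range_ite_lt, sum_range_ite_lt, Finset.sum_sub_distrib,
      hp₀ _ (by omega), hp₁ _ (by omega), hp₁ _ (by omega)]
  rw [Fin.sum_univ_two]
  simp only [Matrix.cons_val_zero, Matrix.cons_val_one]
  rw [sum_range_ite_mem h0 h0n, sum_range_ite_mem h1 h1n, hsum n le_rfl, hsum t₀ h0n, hsum t₁ h1n,
    hsum b₀ (by omega), hsum b₁ (by omega), min_self, min_self, min_eq_right (show b₀ ≤ n by omega),
    min_eq_right (show b₁ ≤ n by omega), min_eq_right h0, min_eq_right h1,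
    min_eq_right (show b₀ ≤ t₁ by omega), min_eq_right (show b₀ ≤ b₁ by omega),
    min_eq_left (show b₀ ≤ b₁ by omega)]
  have e1 : ((f₁ t₁ * (n - t₁ + b₁) + O : ℕ) : ℝ) ≤ ((N b₁ + 2 * p₁ b₁ : ℕ) : ℝ) := by
    exact_mod_cast hN b₁ t₁ h1 h1n
  have e2 : ((f₀ t₀ * (n - t₀ + b₀) + N b₁ + p₁ (min t₀ b₁) + p₁ b₀ : ℕ) : ℝ) ≤
      ((K + 2 * p₀ b₀ : ℕ) : ℝ) := by
    rw [min_comp_of_monotone hmono h0n (by omega)]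
    exact_mod_cast hK b₀ t₀ b₁ h0 h01 h0n (by omega)
  rw [Nat.cast_add, Nat.cast_mul] at e1
  rw [Nat.cast_add, Nat.cast_add, Nat.cast_add, Nat.cast_mul] at e2
  push_cast at e1 e2 hρ ⊢
  linarith

theorem isRatio_three {n Q : ℕ} {ρ : ℝ} {f₀ f₁ f₂ p₀ p₁ p₂ N D T : ℕ → ℕ} {O O' K : ℕ}
    (hp₀ : ∀ k ≤ n, ∑ i ∈ Finset.range k, (f₀ i : ℝ) = p₀ k)
    (hp₁ : ∀ k ≤ n, ∑ i ∈ Finset.range k, (f₁ i : ℝ) = p₁ k)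
    (hp₂ : ∀ k ≤ n, ∑ i ∈ Finset.range k, (f₂ i : ℝ) = p₂ k)
    (hmono : ∀ k k', k ≤ k' → k' ≤ n → p₂ k ≤ p₂ k')
    (hN : ∀ r t, r ≤ t → t ≤ n → f₂ t * (n - t + r) + O ≤ N r + 3 * p₂ r)
    (hD : ∀ b t r, b ≤ t → b ≤ r → t ≤ n → r ≤ n →
      f₁ t * (n - t + b) + N r + min (p₂ t) (p₂ r) ≤ D b)
    (hT : ∀ t b, t ≤ b → b ≤ n → p₁ t + D b + 2 * p₂ b + O' ≤ T t + 3 * p₁ b)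
    (hT' : ∀ b t r q, b ≤ t → b ≤ r → b ≤ q → t ≤ n → r ≤ n → q ≤ n →
      f₁ t * (n - t + b) + N r + min (p₂ t) (p₂ r) + min (p₂ q) (p₂ r) + p₂ b + O' ≤
        T q + 2 * p₁ b)
    (hK : ∀ b t, b ≤ t → t ≤ n → f₀ t * (n - t + b) + T t + 2 * p₁ b ≤ K + 3 * p₀ b)
    (hρ : ρ * (3 * n * Q) + K ≤ 3 * n * Q + O + O') :
    IsRatio n Q ![f₀, f₁, f₂] ρ := by
  intro β θ hβ hθ
  obtain ⟨h0, h0n⟩ := hθ 0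
  obtain ⟨h1, h1n⟩ := hθ 1
  obtain ⟨h2, h2n⟩ := hθ 2
  have h01 : β 0 ≤ β 1 := hβ (by decide)
  have h12 : β 1 ≤ β 2 := hβ (by decide)
  set b₀ := β 0
  set b₁ := β 1
  set b₂ := β 2
  set t₀ := θ 0
  set t₁ := θ 1
  set t₂ := θ 2
  set G : ℕ → ℕ := fun k =>
    if k < b₀ then f₀ k else if k < b₁ then f₁ k else if k < b₂ then f₂ k else 0
  refine ⟨G, fun k _ => ?_, ?_⟩
  · simp only [G]
    split_ifs with h h' h''
    · exact Or.inr ⟨0, h, le_rfl⟩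
    · exact Or.inr ⟨1, h', le_rfl⟩
    · exact Or.inr ⟨2, h'', le_rfl⟩
    · exact Or.inl rfl
  have hG : ∀ k, (G k : ℝ) = (if k < b₀ then (f₀ k : ℝ) - f₁ k else 0) +
      (if k < b₁ then (f₁ k : ℝ) - f₂ k else 0) + (if k < b₂ then (f₂ k : ℝ) else 0) := by
    intro k
    simp only [G]
    split_ifs <;> first | omega | simp
  have hsum : ∀ x ≤ n, ∑ k ∈ Finset.range x, (G k : ℝ) =
      p₀ (min x b₀) - p₁ (min x b₀) + (p₁ (min x b₁) - p₂ (min x b₁)) + p₂ (min x b₂) := by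
    intro x hx
    simp only [hG]
    rw [Finset.sum_add_distrib, Finset.sum_add_distrib, sum_range_ite_lt, sum_range_ite_lt,
      sum_range_ite_lt, Finset.sum_sub_distrib, Finset.sum_sub_distrib,
      hp₀ _ (by omega), hp₁ _ (by omega), hp₁ _ (by omega), hp₂ _ (by omega), hp₂ _ (by omega)]
  rw [Fin.sum_univ_three]
  simp only [Matrix.cons_val_zero, Matrix.cons_val_one, Matrix.cons_val]
  rw [sum_range_ite_mem h0 h0n, sum_range_ite_mem h1 h1n, sum_range_ite_mem h2 h2n,
    hsum n le_rfl, hsum t₀ h0n, hsum t₁ h1n, hsum t₂ h2n,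
    hsum b₀ (by omega), hsum b₁ (by omega), hsum b₂ (by omega), min_self, min_self, min_self,
    min_eq_right (show b₀ ≤ n by omega), min_eq_right (show b₁ ≤ n by omega),
    min_eq_right (show b₂ ≤ n by omega), min_eq_right h0, min_eq_right h1, min_eq_right h2,
    min_eq_right (show b₀ ≤ t₁ by omega), min_eq_right (show b₀ ≤ t₂ by omega),
    min_eq_right (show b₁ ≤ t₂ by omega),
    min_eq_right (show b₀ ≤ b₁ by omega), min_eq_right (show b₀ ≤ b₂ by omega),
    min_eq_right (show b₁ ≤ b₂ by omega),
    min_eq_left (show b₀ ≤ b₁ by omega), min_eq_left (show b₀ ≤ b₂ by omega),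
    min_eq_left (show b₁ ≤ b₂ by omega)]
  have e1 : ((f₂ t₂ * (n - t₂ + b₂) + O : ℕ) : ℝ) ≤ ((N b₂ + 3 * p₂ b₂ : ℕ) : ℝ) := by
    exact_mod_cast hN b₂ t₂ h2 h2n
  have e2 : ((f₀ t₀ * (n - t₀ + b₀) + T t₀ + 2 * p₁ b₀ : ℕ) : ℝ) ≤
      ((K + 3 * p₀ b₀ : ℕ) : ℝ) := by
    exact_mod_cast hK b₀ t₀ h0 h0n
  rw [Nat.cast_add, Nat.cast_mul] at e1
  rw [Nat.cast_add, Nat.cast_add, Nat.cast_mul] at e2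
  have hmin1 := min_comp_of_monotone hmono h1n (show b₂ ≤ n by omega)
  have hmin0 := min_comp_of_monotone hmono h0n (show b₂ ≤ n by omega)
  rcases le_total t₀ b₁ with h | h
  · have e3 : ((f₁ t₁ * (n - t₁ + b₁) + N b₂ + p₂ (min t₁ b₂) : ℕ) : ℝ) ≤ (D b₁ : ℝ) := by
      rw [hmin1]
      exact_mod_cast hD b₁ t₁ b₂ h1 h12 h1n (by omega)
    have e4 : ((p₁ t₀ + D b₁ + 2 * p₂ b₁ + O' : ℕ) : ℝ) ≤ ((T t₀ + 3 * p₁ b₁ : ℕ) : ℝ) := by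
      exact_mod_cast hT t₀ b₁ h (by omega)
    rw [min_eq_left h, min_eq_left (h.trans h12)]
    rw [Nat.cast_add, Nat.cast_add, Nat.cast_mul] at e3
    push_cast at e1 e2 e3 e4 hρ ⊢
    linarith
  · have e3 : ((f₁ t₁ * (n - t₁ + b₁) + N b₂ + p₂ (min t₁ b₂) + p₂ (min t₀ b₂) + p₂ b₁ + O' : ℕ)
        : ℝ) ≤ ((T t₀ + 2 * p₁ b₁ : ℕ) : ℝ) := by
      rw [hmin1, hmin0]
      exact_mod_cast hT' b₁ t₁ b₂ t₀ h1 h12 h h1n (by omega) h0n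
    rw [min_eq_right h]
    rw [Nat.cast_add, Nat.cast_add, Nat.cast_add, Nat.cast_add, Nat.cast_add, Nat.cast_mul] at e3
    push_cast at e1 e2 e3 hρ ⊢
    linarith

/-- `force n k` is `k n`; the kernel evaluates `n` before it unfolds `k`. -/
def force (n : ℕ) (k : ℕ → Bool) : Bool :=
  Nat.rec (k 0) (fun i _ => k (i + 1)) n

theorem force_eq (n : ℕ) (k : ℕ → Bool) : force n k = k n := by
  cases n <;> rfl

section Check

variable {α : Type}

/-- Checks `Q x l` for every decomposition `_ ++ x :: l` of a list. -/
def tailsCheck (Q : α → List α → Bool) : List α → Bool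
  | [] => true
  | x :: l => Q x l && tailsCheck Q l

theorem tailsCheck_getElem {Q : α → List α → Bool} {l : List α} (h : tailsCheck Q l = true)
    (i : ℕ) (hi : i < l.length) : Q l[i] (l.drop (i + 1)) = true := by
  induction l generalizing i with
  | nil => simp at hi
  | cons x l ih =>
    simp only [tailsCheck, Bool.and_eq_true] at h
    cases i with
    | zero => simpa using h.1
    | succ i => simpa using ih h.2 i (by simpa using hi)

/-- Checks `a x + N y + min (φ x) (φ y) ≤ C` for all members `x` and `y` of a list along which `φ`
is monotone. -/
def pairCheck (a N φ : α → ℕ) (C : ℕ) : List α → ℕ → ℕ → Bool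
  | [], _, _ => true
  | x :: l, A, B =>
    force (max A (a x + φ x)) fun A => force (max B (N x + φ x)) fun B =>
      Nat.ble (N x + A) C && (Nat.ble (a x + B) C && pairCheck a N φ C l A B)

theorem pairCheck_sound {a N φ : α → ℕ} {C : ℕ} {l : List α} {A B : ℕ}
    (h : pairCheck a N φ C l A B = true) :
    (∀ x ∈ l, N x + A ≤ C ∧ a x + B ≤ C) ∧
      ∀ x ∈ l, ∀ y ∈ l, a x + N y + min (φ x) (φ y) ≤ C := by
  induction l generalizing A B with
  | nil => simp
  | cons z l ih =>
    simp only [pairCheck, force_eq, Bool.and_eq_true, Nat.ble_eq] at h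
    obtain ⟨h1, h2, h3⟩ := h
    obtain ⟨i1, i2⟩ := ih h3
    have hA := le_max_left A (a z + φ z)
    have hA' := le_max_right A (a z + φ z)
    have hB := le_max_left B (N z + φ z)
    have hB' := le_max_right B (N z + φ z)
    generalize max A (a z + φ z) = A' at *
    generalize max B (N z + φ z) = B' at *
    have hm : ∀ x y, min (φ x) (φ y) ≤ φ x ∧ min (φ x) (φ y) ≤ φ y := fun x y =>
      ⟨min_le_left _ _, min_le_right _ _⟩
    constructor
    · intro x hx
      rcases List.mem_cons.1 hx with rfl | hx'
      · omega
      · have := i1 x hx'; omega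
    · intro x hx y hy
      have := hm x y
      rcases List.mem_cons.1 hx with rfl | hx' <;> rcases List.mem_cons.1 hy with rfl | hy'
      · omega
      · have := i1 y hy'; omega
      · have := i1 x hx'; omega
      · exact i2 x hx' y hy'

/-- Checks `a x + N y + min (φ x) (φ y) + min (φ z) (φ y) ≤ τ z + C` for all members `x`, `y`
and `z` of a list along which `φ` is monotone. -/
def tripleCheck (a N φ τ : α → ℕ) (Z C : ℕ) : List α → ℕ → ℕ → ℕ → ℕ → ℕ → Bool
  | [], _, _, _, _, _ => true
  | x :: l, X, Y, W, XY, YW =>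
    force (max X (a x + φ x)) fun X =>
    force (max Y (N x + 2 * φ x)) fun Y =>
    force (max W (Z + φ x - τ x)) fun W =>
    force (max XY (max (N x + φ x + X) (a x + Y))) fun XY =>
    force (max YW (max (N x + φ x + W) (Y + (Z - τ x)))) fun YW =>
      Nat.ble XY (τ x + C) && (Nat.ble (a x + YW) (Z + C) && (Nat.ble (N x + X + W) (Z + C) &&
        tripleCheck a N φ τ Z C l X Y W XY YW))

theorem tripleCheck_sound {a N φ τ : α → ℕ} {Z C : ℕ} {l : List α} {X Y W XY YW : ℕ}
    (h : tripleCheck a N φ τ Z C l X Y W XY YW = true) :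
    (∀ z ∈ l, XY ≤ τ z + C) ∧ (∀ x ∈ l, a x + YW ≤ Z + C) ∧ (∀ y ∈ l, N y + X + W ≤ Z + C) ∧
      (∀ y ∈ l, ∀ z ∈ l, X + N y + min (φ z) (φ y) ≤ τ z + C) ∧
      (∀ x ∈ l, ∀ z ∈ l, a x + Y ≤ τ z + C) ∧
      (∀ x ∈ l, ∀ y ∈ l, a x + N y + min (φ x) (φ y) + W ≤ Z + C) ∧
      ∀ x ∈ l, ∀ y ∈ l, ∀ z ∈ l,
        a x + N y + min (φ x) (φ y) + min (φ z) (φ y) ≤ τ z + C := by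
  induction l generalizing X Y W XY YW with
  | nil => simp
  | cons o l ih =>
    simp only [tripleCheck, force_eq, Bool.and_eq_true, Nat.ble_eq] at h
    obtain ⟨X', hX'⟩ : ∃ X', X' = max X (a o + φ o) := ⟨_, rfl⟩
    obtain ⟨Y', hY'⟩ : ∃ Y', Y' = max Y (N o + 2 * φ o) := ⟨_, rfl⟩
    obtain ⟨W', hW'⟩ : ∃ W', W' = max W (Z + φ o - τ o) := ⟨_, rfl⟩
    rw [← hX', ← hY', ← hW'] at h
    obtain ⟨XY', hXY'⟩ : ∃ XY', XY' = max XY (max (N o + φ o + X') (a o + Y')) := ⟨_, rfl⟩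
    obtain ⟨YW', hYW'⟩ : ∃ YW', YW' = max YW (max (N o + φ o + W') (Y' + (Z - τ o))) := ⟨_, rfl⟩
    rw [← hXY', ← hYW'] at h
    obtain ⟨h1, h2, h3, h4⟩ := h
    obtain ⟨i1, i2, i3, i4, i5, i6, i7⟩ := ih h4
    have hX : X ≤ X' ∧ a o + φ o ≤ X' := by omega
    have hY : Y ≤ Y' ∧ N o + 2 * φ o ≤ Y' := by omega
    have hW : W ≤ W' ∧ Z + φ o ≤ W' + τ o := by omega
    have hXY : XY ≤ XY' ∧ N o + φ o + X' ≤ XY' ∧ a o + Y' ≤ XY' := by omega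
    have hYW : YW ≤ YW' ∧ N o + φ o + W' ≤ YW' ∧ Y' + Z ≤ YW' + τ o := by omega
    clear hX' hY' hW' hXY' hYW' ih h4
    have hm : ∀ x y, min (φ x) (φ y) ≤ φ x ∧ min (φ x) (φ y) ≤ φ y := fun x y =>
      ⟨min_le_left _ _, min_le_right _ _⟩
    refine ⟨?_, ?_, ?_, ?_, ?_, ?_, ?_⟩
    · intro z hz
      rcases List.mem_cons.1 hz with rfl | hz'
      · omega
      · have := i1 z hz'; omega
    · intro x hx
      rcases List.mem_cons.1 hx with rfl | hx'
      · omega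
      · have := i2 x hx'; omega
    · intro y hy
      rcases List.mem_cons.1 hy with rfl | hy'
      · omega
      · have := i3 y hy'; omega
    · intro y hy z hz
      have := hm z y
      rcases List.mem_cons.1 hy with rfl | hy' <;> rcases List.mem_cons.1 hz with rfl | hz'
      · omega
      · have := i1 z hz'; omega
      · have := i3 y hy'; omega
      · have := i4 y hy' z hz'; omega
    · intro x hx z hz
      rcases List.mem_cons.1 hx with rfl | hx' <;> rcases List.mem_cons.1 hz with rfl | hz'
      · omega
      · have := i1 z hz'; omega
      · have := i2 x hx'; omega
      · have := i5 x hx' z hz'; omega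
    · intro x hx y hy
      have := hm x y
      rcases List.mem_cons.1 hx with rfl | hx' <;> rcases List.mem_cons.1 hy with rfl | hy'
      · omega
      · have := i3 y hy'; omega
      · have := i2 x hx'; omega
      · have := i6 x hx' y hy'; omega
    · intro x hx y hy z hz
      have := hm x y
      have := hm z y
      rcases List.mem_cons.1 hx with rfl | hx' <;> rcases List.mem_cons.1 hy with rfl | hy' <;>
        rcases List.mem_cons.1 hz with rfl | hz'
      · omega
      · have := i1 z hz'; omega
      · have := i3 y hy'; omega
      · have := i4 y hy' z hz'; omega
      · have := i2 x hx'; omega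
      · have := i5 x hx' z hz'; omega
      · have := i6 x hx' y hy'; omega
      · exact i7 x hx' y hy' z hz'

/-- The entry at position `i` of a list, and its last entry beyond the end. -/
def rowAt (l : List α) (last : α) (i : ℕ) : α := l.getD i last

theorem rowAt_of_tailsCheck {Q : α → List α → Bool} {l : List α} {last : α} {n : ℕ}
    (hl : l.length = n + 1) (h : tailsCheck Q l = true) {i : ℕ} (hi : i ≤ n) :
    Q (rowAt l last i) (l.drop (i + 1)) = true := by
  have := tailsCheck_getElem h i (by omega)
  rwa [rowAt, List.getD_eq_getElem _ _ (by omega)]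

theorem rowAt_mem {l : List α} {last : α} {n : ℕ} (hl : l.length = n + 1) {i j : ℕ} (hij : i ≤ j)
    (hj : j ≤ n) : rowAt l last j ∈ rowAt l last i :: l.drop (i + 1) := by
  rw [rowAt, rowAt, List.getD_eq_getElem _ _ (by omega), List.getD_eq_getElem _ _ (by omega),
    ← List.drop_eq_getElem_cons (by omega), List.mem_iff_getElem]
  exact ⟨j - i, by simp; omega, by simp [hij]⟩

theorem drop_eq_rowAt_cons {l : List α} {last : α} {n : ℕ} (hl : l.length = n + 1) {i : ℕ}
    (hi : i ≤ n) : l.drop i = rowAt l last i :: l.drop (i + 1) := by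
  rw [rowAt, List.getD_eq_getElem _ _ (by omega), ← List.drop_eq_getElem_cons (by omega)]

end Check

theorem isPriceTable_two {n Q : ℕ} {f₀ f₁ : ℕ → ℕ} (hn : 0 < n) (hQ : 0 < Q)
    (h₀ : ∀ k < n, f₀ k ≤ f₀ (k + 1)) (h₁ : ∀ k < n, f₁ k ≤ f₁ (k + 1))
    (h : ∀ k ≤ n, f₁ k ≤ f₀ k) (t₀ : f₀ n = Q) (t₁ : f₁ n = Q) :
    IsPriceTable n Q ![f₀, f₁] where
  antitone_stage k hk := by
    rw [Fin.antitone_iff_succ_le]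
    intro i
    fin_cases i
    exact h k hk
  monotone_level j k k' hk hk' := by
    fin_cases j
    exacts [monotone_of_le_succ h₀ hk hk', monotone_of_le_succ h₁ hk hk']
  top j := by
    fin_cases j
    exacts [t₀, t₁]
  level_pos := hn
  scale_pos := hQ

theorem isPriceTable_three {n Q : ℕ} {f₀ f₁ f₂ : ℕ → ℕ} (hn : 0 < n) (hQ : 0 < Q)
    (h₀ : ∀ k < n, f₀ k ≤ f₀ (k + 1)) (h₁ : ∀ k < n, f₁ k ≤ f₁ (k + 1))
    (h₂ : ∀ k < n, f₂ k ≤ f₂ (k + 1)) (h : ∀ k ≤ n, f₁ k ≤ f₀ k) (h' : ∀ k ≤ n, f₂ k ≤ f₁ k)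
    (t₀ : f₀ n = Q) (t₁ : f₁ n = Q) (t₂ : f₂ n = Q) :
    IsPriceTable n Q ![f₀, f₁, f₂] where
  antitone_stage k hk := by
    rw [Fin.antitone_iff_succ_le]
    intro i
    fin_cases i
    exacts [h k hk, h' k hk]
  monotone_level j k k' hk hk' := by
    fin_cases j
    exacts [monotone_of_le_succ h₀ hk hk', monotone_of_le_succ h₁ hk hk',
      monotone_of_le_succ h₂ hk hk']
  top j := by
    fin_cases j
    exacts [t₀, t₁, t₂]
  level_pos := hn
  scale_pos := hQ

/-- A row of a price table for two stages: the level, the two prices, their sums over the lower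
levels, and a bound for the second stage. -/
structure TwoStageRow where
  level : ℕ
  price₀ : ℕ
  price₁ : ℕ
  sum₀ : ℕ
  sum₁ : ℕ
  bound : ℕ

namespace TwoStageRow

/-- Compares a row with the next one. -/
def next (s t : TwoStageRow) : Bool :=
  Nat.beq t.level (s.level + 1) && (Nat.beq t.sum₀ (s.sum₀ + s.price₀) &&
    (Nat.beq t.sum₁ (s.sum₁ + s.price₁) && (Nat.ble s.price₀ t.price₀ &&
      Nat.ble s.price₁ t.price₁)))

/-- Compares a row with all later ones. -/
def check (n O K : ℕ) (s : TwoStageRow) (l : List TwoStageRow) : Bool :=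
  Nat.ble s.price₁ s.price₀ && ((l.take 1).all (next s) &&
    ((s :: l).all (fun t => Nat.ble (t.price₁ * (n - t.level + s.level) + O)
        (s.bound + 2 * s.sum₁)) &&
      pairCheck (fun t => t.price₀ * (n - t.level + s.level) + s.sum₁) bound sum₁
        (K + 2 * s.sum₀) (s :: l) 0 0))

theorem sound {rows : List TwoStageRow} {last : TwoStageRow} {n Q O K : ℕ}
    (hl : rows.length = n + 1) (hc : tailsCheck (check n O K) rows = true) (hn : 0 < n)
    (hQ : 0 < Q) (hfirst : (rowAt rows last 0).level = 0 ∧ (rowAt rows last 0).sum₀ = 0 ∧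
      (rowAt rows last 0).sum₁ = 0)
    (hlast : (rowAt rows last n).price₀ = Q ∧ (rowAt rows last n).price₁ = Q) :
    IsPriceTable n Q ![fun k => (rowAt rows last k).price₀, fun k => (rowAt rows last k).price₁] ∧
      ∀ ρ : ℝ, ρ * (2 * n * Q) + K ≤ 2 * n * Q + O →
        IsRatio n Q ![fun k => (rowAt rows last k).price₀, fun k => (rowAt rows last k).price₁]
          ρ := by
  have hrow := fun {i} hi => rowAt_of_tailsCheck (last := last) hl hc (i := i) hi
  simp only [check, Bool.and_eq_true, Nat.ble_eq, List.all_eq_true] at hrow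
  have hnext : ∀ k < n, (rowAt rows last (k + 1)).level = (rowAt rows last k).level + 1 ∧
      (rowAt rows last (k + 1)).sum₀ = (rowAt rows last k).sum₀ + (rowAt rows last k).price₀ ∧
      (rowAt rows last (k + 1)).sum₁ = (rowAt rows last k).sum₁ + (rowAt rows last k).price₁ ∧
      (rowAt rows last k).price₀ ≤ (rowAt rows last (k + 1)).price₀ ∧
      (rowAt rows last k).price₁ ≤ (rowAt rows last (k + 1)).price₁ := by
    intro k hk
    have := (hrow hk.le).2.1 (rowAt rows last (k + 1))
      (by rw [drop_eq_rowAt_cons (last := last) hl (i := k + 1) hk]; simp)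
    simpa only [next, Bool.and_eq_true, Nat.ble_eq, Nat.beq_eq] using this
  have hlevel : ∀ k ≤ n, (rowAt rows last k).level = k := by
    intro k hk
    induction k with
    | zero => exact hfirst.1
    | succ k ih => rw [(hnext k hk).1, ih (by omega)]
  refine ⟨isPriceTable_two hn hQ (fun k hk => (hnext k hk).2.2.2.1)
    (fun k hk => (hnext k hk).2.2.2.2) (fun k hk => (hrow hk).1) hlast.1 hlast.2, fun ρ hρ => ?_⟩
  refine isRatio_two (p₀ := fun k => (rowAt rows last k).sum₀)
    (p₁ := fun k => (rowAt rows last k).sum₁) (N := fun k => (rowAt rows last k).bound)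
    (fun k hk => sum_range_eq_of_succ (p := fun k => (rowAt rows last k).sum₀)
      (f := fun k => (rowAt rows last k).price₀) hfirst.2.1 (fun k hk => (hnext k hk).2.1) hk)
    (fun k hk => sum_range_eq_of_succ (p := fun k => (rowAt rows last k).sum₁)
      (f := fun k => (rowAt rows last k).price₁) hfirst.2.2 (fun k hk => (hnext k hk).2.2.1) hk)
    (fun k k' hk hk' => monotone_of_le_succ (g := fun k => (rowAt rows last k).sum₁)
      (fun k hk => by simp only [(hnext k hk).2.2.1]; exact Nat.le_add_right _ _) hk hk')
    (fun r t hrt ht => ?_) (fun b t r hbt hbr ht hr => ?_) hρ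
  · have := (hrow (hrt.trans ht)).2.2.1 _ (rowAt_mem hl hrt ht)
    rwa [hlevel t ht, hlevel r (hrt.trans ht)] at this
  · have := (pairCheck_sound (hrow (hbt.trans ht)).2.2.2).2 _ (rowAt_mem hl hbt ht) _
      (rowAt_mem hl hbr hr)
    rw [hlevel t ht, hlevel b (hbt.trans ht)] at this
    linarith

end TwoStageRow

/-- A row of a price table for three stages: the level, the three prices, their sums over the
lower levels, and bounds for the third stage, for the last two stages, and for the last two stages
given the upper threshold of the first one. -/
structure ThreeStageRow where
  level : ℕ
  price₀ : ℕ
  price₁ : ℕ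
  price₂ : ℕ
  sum₀ : ℕ
  sum₁ : ℕ
  sum₂ : ℕ
  bound₂ : ℕ
  bound₁ : ℕ
  bound₀ : ℕ

namespace ThreeStageRow

/-- Compares a row with the next one. -/
def next (s t : ThreeStageRow) : Bool :=
  Nat.beq t.level (s.level + 1) && (Nat.beq t.sum₀ (s.sum₀ + s.price₀) &&
    (Nat.beq t.sum₁ (s.sum₁ + s.price₁) && (Nat.beq t.sum₂ (s.sum₂ + s.price₂) &&
      (Nat.ble s.price₀ t.price₀ && (Nat.ble s.price₁ t.price₁ &&
        Nat.ble s.price₂ t.price₂)))))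

/-- Compares a row with all later ones. -/
def check (n O O' K Z : ℕ) (s : ThreeStageRow) (l : List ThreeStageRow) : Bool :=
  Nat.ble s.price₁ s.price₀ && (Nat.ble s.price₂ s.price₁ && ((l.take 1).all (next s) &&
    ((s :: l).all (fun t =>
        Nat.ble (t.price₂ * (n - t.level + s.level) + O) (s.bound₂ + 3 * s.sum₂) &&
        (Nat.ble (s.sum₁ + t.bound₁ + 2 * t.sum₂ + O') (s.bound₀ + 3 * t.sum₁) &&
        Nat.ble (t.price₀ * (n - t.level + s.level) + t.bound₀ + 2 * s.sum₁)
          (K + 3 * s.sum₀))) &&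
      (pairCheck (fun t => t.price₁ * (n - t.level + s.level)) bound₂ sum₂ s.bound₁
        (s :: l) 0 0 &&
      tripleCheck (fun t => t.price₁ * (n - t.level + s.level) + s.sum₂ + O') bound₂ sum₂ bound₀
        Z (2 * s.sum₁) (s :: l) 0 0 0 0 0))))

theorem sound {rows : List ThreeStageRow} {last : ThreeStageRow} {n Q O O' K Z : ℕ}
    (hl : rows.length = n + 1) (hc : tailsCheck (check n O O' K Z) rows = true) (hn : 0 < n)
    (hQ : 0 < Q) (hfirst : (rowAt rows last 0).level = 0 ∧ (rowAt rows last 0).sum₀ = 0 ∧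
      (rowAt rows last 0).sum₁ = 0 ∧ (rowAt rows last 0).sum₂ = 0)
    (hlast : (rowAt rows last n).price₀ = Q ∧ (rowAt rows last n).price₁ = Q ∧
      (rowAt rows last n).price₂ = Q) :
    IsPriceTable n Q ![fun k => (rowAt rows last k).price₀, fun k => (rowAt rows last k).price₁,
        fun k => (rowAt rows last k).price₂] ∧
      ∀ ρ : ℝ, ρ * (3 * n * Q) + K ≤ 3 * n * Q + O + O' →
        IsRatio n Q ![fun k => (rowAt rows last k).price₀, fun k => (rowAt rows last k).price₁,
          fun k => (rowAt rows last k).price₂] ρ := by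
  have hrow := fun {i} hi => rowAt_of_tailsCheck (last := last) hl hc (i := i) hi
  simp only [check, Bool.and_eq_true, Nat.ble_eq, List.all_eq_true] at hrow
  have hnext : ∀ k < n, (rowAt rows last (k + 1)).level = (rowAt rows last k).level + 1 ∧
      (rowAt rows last (k + 1)).sum₀ = (rowAt rows last k).sum₀ + (rowAt rows last k).price₀ ∧
      (rowAt rows last (k + 1)).sum₁ = (rowAt rows last k).sum₁ + (rowAt rows last k).price₁ ∧
      (rowAt rows last (k + 1)).sum₂ = (rowAt rows last k).sum₂ + (rowAt rows last k).price₂ ∧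
      (rowAt rows last k).price₀ ≤ (rowAt rows last (k + 1)).price₀ ∧
      (rowAt rows last k).price₁ ≤ (rowAt rows last (k + 1)).price₁ ∧
      (rowAt rows last k).price₂ ≤ (rowAt rows last (k + 1)).price₂ := by
    intro k hk
    have := (hrow hk.le).2.2.1 (rowAt rows last (k + 1))
      (by rw [drop_eq_rowAt_cons (last := last) hl (i := k + 1) hk]; simp)
    simpa only [next, Bool.and_eq_true, Nat.ble_eq, Nat.beq_eq] using this
  have hlevel : ∀ k ≤ n, (rowAt rows last k).level = k := by
    intro k hk
    induction k with
    | zero => exact hfirst.1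
    | succ k ih => rw [(hnext k hk).1, ih (by omega)]
  refine ⟨isPriceTable_three hn hQ (fun k hk => (hnext k hk).2.2.2.2.1)
    (fun k hk => (hnext k hk).2.2.2.2.2.1) (fun k hk => (hnext k hk).2.2.2.2.2.2)
    (fun k hk => (hrow hk).1) (fun k hk => (hrow hk).2.1) hlast.1 hlast.2.1 hlast.2.2,
    fun ρ hρ => ?_⟩
  have hall := fun {b t} (hbt : b ≤ t) (ht : t ≤ n) =>
    (hrow (hbt.trans ht)).2.2.2.1 _ (rowAt_mem hl hbt ht)
  refine isRatio_three (p₀ := fun k => (rowAt rows last k).sum₀)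
    (p₁ := fun k => (rowAt rows last k).sum₁) (p₂ := fun k => (rowAt rows last k).sum₂)
    (N := fun k => (rowAt rows last k).bound₂) (D := fun k => (rowAt rows last k).bound₁)
    (T := fun k => (rowAt rows last k).bound₀)
    (fun k hk => sum_range_eq_of_succ (p := fun k => (rowAt rows last k).sum₀)
      (f := fun k => (rowAt rows last k).price₀) hfirst.2.1 (fun k hk => (hnext k hk).2.1) hk)
    (fun k hk => sum_range_eq_of_succ (p := fun k => (rowAt rows last k).sum₁)
      (f := fun k => (rowAt rows last k).price₁) hfirst.2.2.1 (fun k hk => (hnext k hk).2.2.1) hk)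
    (fun k hk => sum_range_eq_of_succ (p := fun k => (rowAt rows last k).sum₂)
      (f := fun k => (rowAt rows last k).price₂) hfirst.2.2.2 (fun k hk => (hnext k hk).2.2.2.1) hk)
    (fun k k' hk hk' => monotone_of_le_succ (g := fun k => (rowAt rows last k).sum₂)
      (fun k hk => by simp only [(hnext k hk).2.2.2.1]; exact Nat.le_add_right _ _) hk hk')
    (fun r t hrt ht => ?_) (fun b t r hbt hbr ht hr => ?_) (fun t b htb hb => (hall htb hb).2.1)
    (fun b t r q hbt hbr hbq ht hr hq => ?_) (fun b t hbt ht => ?_) hρ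
  · have := (hall hrt ht).1
    rwa [hlevel t ht, hlevel r (hrt.trans ht)] at this
  · have := (pairCheck_sound (hrow (hbt.trans ht)).2.2.2.2.1).2 _ (rowAt_mem hl hbt ht) _
      (rowAt_mem hl hbr hr)
    rwa [hlevel t ht, hlevel b (hbt.trans ht)] at this
  · have := (tripleCheck_sound (hrow (hbt.trans ht)).2.2.2.2.2).2.2.2.2.2.2 _
      (rowAt_mem hl hbt ht) _ (rowAt_mem hl hbr hr) _ (rowAt_mem hl hbq hq)
    rw [hlevel t ht, hlevel b (hbt.trans ht)] at this
    linarith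
  · have := (hall hbt ht).2.2
    rwa [hlevel t ht, hlevel b (hbt.trans ht)] at this

end ThreeStageRow

/-- A price table for two stages. -/
def twoStageTable : List TwoStageRow :=
  [⟨0, 59402, 34188, 0, 0, 48662271⟩, ⟨1, 59615, 34317, 59402, 34188, 48629112⟩,
    ⟨2, 59828, 34446, 119017, 68505, 48595698⟩, ⟨3, 60041, 34575, 178845, 102951, 48562152⟩,
    ⟨4, 60254, 34704, 238886, 137526, 48528636⟩, ⟨5, 60467, 34833, 299140, 172230, 48495912⟩,
    ⟨6, 60680, 34962, 359607, 207063, 48462954⟩, ⟨7, 60893, 35091, 420287, 242025, 48429852⟩,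
    ⟨8, 61106, 35220, 481180, 277116, 48396516⟩, ⟨9, 61319, 35349, 542286, 312336, 48364772⟩,
    ⟨10, 61532, 35478, 603605, 347685, 48333190⟩, ⟨11, 61745, 35607, 665137, 383163, 48301392⟩,
    ⟨12, 61958, 35736, 726882, 418770, 48269448⟩, ⟨13, 62171, 35865, 788840, 454506, 48237288⟩,
    ⟨14, 62384, 35994, 851011, 490371, 48205715⟩, ⟨15, 62607, 36132, 913395, 526365, 48174634⟩,
    ⟨16, 62830, 36270, 976002, 562497, 48143290⟩, ⟨17, 63053, 36408, 1038832, 598767, 48111822⟩,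
    ⟨18, 63276, 36546, 1101885, 635175, 48080091⟩, ⟨19, 63499, 36684, 1165161, 671721, 48048236⟩,
    ⟨20, 63722, 36822, 1228660, 708405, 48017778⟩, ⟨21, 63945, 36960, 1292382, 745227, 47987814⟩,
    ⟨22, 64168, 37098, 1356327, 782187, 47957686⟩, ⟨23, 64391, 37236, 1420495, 819285, 47927354⟩,
    ⟨24, 64614, 37374, 1484886, 856521, 47897203⟩, ⟨25, 64837, 37512, 1549500, 893895, 47868484⟩,
    ⟨26, 65060, 37650, 1614337, 931407, 47839634⟩, ⟨27, 65283, 37788, 1679397, 969057, 47810564⟩,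
    ⟨28, 65506, 37926, 1744680, 1006845, 47781363⟩,
    ⟨29, 65735, 38080, 1810186, 1044771, 47751942⟩,
    ⟨30, 65964, 38234, 1875921, 1082851, 47722358⟩,
    ⟨31, 66193, 38388, 1941885, 1121085, 47692522⟩,
    ⟨32, 66422, 38542, 2008078, 1159473, 47664168⟩,
    ⟨33, 66651, 38696, 2074500, 1198015, 47636144⟩,
    ⟨34, 66880, 38850, 2141151, 1236711, 47607854⟩,
    ⟨35, 67109, 39004, 2208031, 1275561, 47579434⟩,
    ⟨36, 67338, 39158, 2275140, 1314565, 47550748⟩,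
    ⟨37, 67567, 39312, 2342478, 1353723, 47521932⟩,
    ⟨38, 67796, 39466, 2410045, 1393035, 47495406⟩,
    ⟨39, 68025, 39620, 2477841, 1432501, 47468904⟩,
    ⟨40, 68254, 39774, 2545866, 1472121, 47442241⟩,
    ⟨41, 68483, 39928, 2614120, 1511895, 47415368⟩,
    ⟨42, 68712, 40082, 2682603, 1551823, 47388334⟩,
    ⟨43, 68950, 40247, 2751315, 1591905, 47361090⟩,
    ⟨44, 69188, 40412, 2820265, 1632152, 47333663⟩,
    ⟨45, 69426, 40577, 2889453, 1672564, 47306004⟩,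
    ⟨46, 69664, 40742, 2958879, 1713141, 47280099⟩,
    ⟨47, 69902, 40907, 3028543, 1753883, 47254232⟩,
    ⟨48, 70140, 41072, 3098445, 1794790, 47228068⟩,
    ⟨49, 70378, 41237, 3168585, 1835862, 47201806⟩,
    ⟨50, 70616, 41402, 3238963, 1877099, 47175247⟩,
    ⟨51, 70854, 41567, 3309579, 1918501, 47148590⟩,
    ⟨52, 71092, 41732, 3380433, 1960068, 47121636⟩,
    ⟨53, 71330, 41897, 3451525, 2001800, 47094584⟩,
    ⟨54, 71568, 42062, 3522855, 2043697, 47070190⟩,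
    ⟨55, 71806, 42227, 3594423, 2085759, 47045858⟩,
    ⟨56, 72044, 42392, 3666229, 2127986, 47021478⟩,
    ⟨57, 72300, 42576, 3738273, 2170378, 46996782⟩,
    ⟨58, 72556, 42760, 3810573, 2212954, 46972000⟩,
    ⟨59, 72812, 42944, 3883129, 2255714, 46946864⟩,
    ⟨60, 73068, 43128, 3955941, 2298658, 46921642⟩,
    ⟨61, 73324, 43312, 4029009, 2341786, 46896066⟩,
    ⟨62, 73580, 43496, 4102333, 2385098, 46870404⟩,
    ⟨63, 73836, 43680, 4175913, 2428594, 46844388⟩,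
    ⟨64, 74092, 43864, 4249749, 2472274, 46819171⟩,
    ⟨65, 74348, 44048, 4323841, 2516138, 46794758⟩,
    ⟨66, 74604, 44232, 4398189, 2560186, 46770068⟩,
    ⟨67, 74860, 44416, 4472793, 2604418, 46745234⟩,
    ⟨68, 75116, 44600, 4547653, 2648834, 46720123⟩,
    ⟨69, 75372, 44784, 4622769, 2693434, 46694868⟩,
    ⟨70, 75628, 44968, 4698141, 2738218, 46669336⟩,
    ⟨71, 75908, 45169, 4773769, 2783186, 46643660⟩,
    ⟨72, 76188, 45370, 4849677, 2828355, 46617673⟩,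
    ⟨73, 76468, 45571, 4925865, 2873725, 46591508⟩,
    ⟨74, 76748, 45772, 5002333, 2919296, 46565032⟩,
    ⟨75, 77028, 45973, 5079081, 2965068, 46538378⟩,
    ⟨76, 77308, 46174, 5156109, 3011041, 46511413⟩,
    ⟨77, 77588, 46375, 5233417, 3057215, 46486646⟩,
    ⟨78, 77868, 46576, 5311005, 3103590, 46462172⟩,
    ⟨79, 78148, 46777, 5388873, 3150166, 46437476⟩,
    ⟨80, 78428, 46978, 5467021, 3196943, 46412542⟩,
    ⟨81, 78708, 47179, 5545449, 3243921, 46387386⟩,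
    ⟨82, 78988, 47380, 5624157, 3291100, 46361992⟩,
    ⟨83, 79268, 47581, 5703145, 3338480, 46336376⟩,
    ⟨84, 79548, 47782, 5782413, 3386061, 46313306⟩,
    ⟨85, 79832, 48002, 5861961, 3433843, 46291462⟩,
    ⟨86, 80116, 48222, 5941793, 3481845, 46269546⟩,
    ⟨87, 80400, 48442, 6021909, 3530067, 46247210⟩,
    ⟨88, 80684, 48662, 6102309, 3578509, 46224802⟩,
    ⟨89, 80968, 48882, 6182993, 3627171, 46201974⟩,
    ⟨90, 81252, 49102, 6263961, 3676053, 46179074⟩,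
    ⟨91, 81536, 49322, 6345213, 3725155, 46157814⟩,
    ⟨92, 81820, 49542, 6426749, 3774477, 46138114⟩,
    ⟨93, 82104, 49762, 6508569, 3824019, 46118210⟩,
    ⟨94, 82388, 49982, 6590673, 3873781, 46098058⟩,
    ⟨95, 82672, 50202, 6673061, 3923763, 46077702⟩,
    ⟨96, 82956, 50422, 6755733, 3973965, 46057098⟩,
    ⟨97, 83240, 50642, 6838689, 4024387, 46036404⟩,
    ⟨98, 83524, 50862, 6921929, 4075029, 46020850⟩,
    ⟨99, 83707, 51107, 7005453, 4125891, 46017370⟩,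
    ⟨100, 83890, 51352, 7089160, 4176998, 46017769⟩,
    ⟨101, 84073, 51597, 7173050, 4228350, 46018024⟩,
    ⟨102, 84256, 51842, 7257123, 4279947, 46018134⟩,
    ⟨103, 84439, 52087, 7341379, 4331789, 46018100⟩,
    ⟨104, 84622, 52332, 7425818, 4383876, 46017921⟩,
    ⟨105, 84805, 52577, 7510440, 4436208, 46017598⟩,
    ⟨106, 84988, 52822, 7595245, 4488785, 46017130⟩,
    ⟨107, 85171, 53067, 7680233, 4541607, 46016518⟩,
    ⟨108, 85354, 53312, 7765404, 4594674, 46015761⟩,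
    ⟨109, 85537, 53557, 7850758, 4647986, 46014860⟩,
    ⟨110, 85720, 53802, 7936295, 4701543, 46013814⟩,
    ⟨111, 85903, 54047, 8022015, 4755345, 46014430⟩,
    ⟨112, 86086, 54292, 8107918, 4809392, 46015228⟩,
    ⟨113, 86270, 54557, 8194004, 4863684, 46016236⟩,
    ⟨114, 86454, 54822, 8280274, 4918241, 46016735⟩,
    ⟨115, 86638, 55087, 8366728, 4973063, 46017404⟩,
    ⟨116, 86822, 55352, 8453366, 5028150, 46017564⟩,
    ⟨117, 87006, 55617, 8540188, 5083502, 46017894⟩,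
    ⟨118, 87190, 55882, 8627194, 5139119, 46017715⟩,
    ⟨119, 87374, 56147, 8714384, 5195001, 46017706⟩,
    ⟨120, 87558, 56412, 8801758, 5251148, 46017188⟩,
    ⟨121, 87742, 56677, 8889316, 5307560, 46016840⟩,
    ⟨122, 87926, 56942, 8977058, 5364237, 46015983⟩,
    ⟨123, 88110, 57207, 9064984, 5421179, 46015296⟩,
    ⟨124, 88294, 57472, 9153094, 5478386, 46014100⟩,
    ⟨125, 88478, 57737, 9241388, 5535858, 46013074⟩,
    ⟨126, 88662, 58002, 9329866, 5593595, 46011539⟩,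
    ⟨127, 88844, 58298, 9418528, 5651597, 46010174⟩,
    ⟨128, 89026, 58594, 9507372, 5709895, 46008238⟩,
    ⟨129, 89208, 58890, 9596398, 5768489, 46006410⟩,
    ⟨130, 89390, 59186, 9685606, 5827379, 46004011⟩,
    ⟨131, 89572, 59482, 9774996, 5886565, 46001720⟩,
    ⟨132, 89754, 59778, 9864568, 5946047, 46000550⟩,
    ⟨133, 89936, 60074, 9954322, 6005825, 46000126⟩,
    ⟨134, 90118, 60370, 10044258, 6065899, 45999784⟩,
    ⟨135, 90300, 60666, 10134376, 6126269, 45998930⟩,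
    ⟨136, 90482, 60962, 10224676, 6186935, 45998158⟩,
    ⟨137, 90664, 61258, 10315158, 6247897, 45996874⟩,
    ⟨138, 90846, 61554, 10405822, 6309155, 45995672⟩,
    ⟨139, 91028, 61850, 10496668, 6370709, 45993958⟩,
    ⟨140, 91210, 62146, 10587696, 6432559, 45992326⟩,
    ⟨141, 91387, 62461, 10678906, 6494705, 45990182⟩,
    ⟨142, 91564, 62776, 10770293, 6557166, 45988082⟩,
    ⟨143, 91741, 63091, 10861857, 6619942, 45985432⟩,
    ⟨144, 91918, 63406, 10953598, 6683033, 45982826⟩,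
    ⟨145, 92095, 63721, 11045516, 6746439, 45979670⟩,
    ⟨146, 92272, 64036, 11137611, 6810160, 45976558⟩,
    ⟨147, 92449, 64351, 11229883, 6874196, 45980636⟩,
    ⟨148, 92626, 64666, 11322332, 6938547, 45984534⟩,
    ⟨149, 92803, 64981, 11414958, 7003213, 45988402⟩,
    ⟨150, 92980, 65296, 11507761, 7068194, 45991890⟩,
    ⟨151, 93157, 65611, 11600741, 7133490, 45995348⟩,
    ⟨152, 93334, 65926, 11693898, 7199101, 45998426⟩,
    ⟨153, 93511, 66241, 11787232, 7265027, 46001474⟩,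
    ⟨154, 93688, 66556, 11880743, 7331268, 46004142⟩,
    ⟨155, 93855, 66900, 11974431, 7397824, 46006780⟩,
    ⟨156, 94022, 67244, 12068286, 7464724, 46008980⟩,
    ⟨157, 94189, 67588, 12162308, 7531968, 46011092⟩,
    ⟨158, 94356, 67932, 12256497, 7599556, 46012766⟩,
    ⟨159, 94523, 68276, 12350853, 7667488, 46014352⟩,
    ⟨160, 94690, 68620, 12445376, 7735764, 46015500⟩,
    ⟨161, 94857, 68964, 12540066, 7804384, 46016560⟩,
    ⟨162, 95024, 69308, 12634923, 7873348, 46017182⟩,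
    ⟨163, 95191, 69652, 12729947, 7942656, 46017716⟩,
    ⟨164, 95358, 69996, 12825138, 8012308, 46017812⟩,
    ⟨165, 95525, 70340, 12920496, 8082304, 46017820⟩,
    ⟨166, 95692, 70684, 13016021, 8152644, 46017140⟩,
    ⟨167, 95859, 71028, 13111713, 8223328, 46015772⟩,
    ⟨168, 96026, 71372, 13207572, 8294356, 46013716⟩,
    ⟨169, 96231, 71760, 13303598, 8365728, 46010972⟩,
    ⟨170, 96436, 72148, 13399829, 8437488, 46007452⟩,
    ⟨171, 96641, 72536, 13496265, 8509636, 46003156⟩,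
    ⟨172, 96846, 72924, 13592906, 8582172, 45998084⟩,
    ⟨173, 97051, 73312, 13689752, 8655096, 45992236⟩,
    ⟨174, 97256, 73700, 13786803, 8728408, 45985612⟩,
    ⟨175, 97461, 74088, 13884059, 8802108, 45978212⟩,
    ⟨176, 97666, 74476, 13981520, 8876196, 45970036⟩,
    ⟨177, 97871, 74864, 14079186, 8950672, 45961084⟩,
    ⟨178, 98076, 75252, 14177057, 9025536, 45951356⟩,
    ⟨179, 98281, 75640, 14275133, 9100788, 45940852⟩,
    ⟨180, 98486, 76028, 14373414, 9176428, 45929572⟩,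
    ⟨181, 98691, 76416, 14471900, 9252456, 45917516⟩,
    ⟨182, 98896, 76804, 14570591, 9328872, 45904684⟩,
    ⟨183, 99181, 77232, 14669487, 9405676, 45891076⟩,
    ⟨184, 99466, 77660, 14768668, 9482908, 45876612⟩,
    ⟨185, 99751, 78088, 14868134, 9560568, 45861292⟩,
    ⟨186, 100036, 78516, 14967885, 9638656, 45845116⟩,
    ⟨187, 100321, 78944, 15067921, 9717172, 45828084⟩,
    ⟨188, 100606, 79372, 15168242, 9796116, 45810196⟩,
    ⟨189, 100891, 79800, 15268848, 9875488, 45791452⟩,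
    ⟨190, 101176, 80228, 15369739, 9955288, 45771852⟩,
    ⟨191, 101461, 80656, 15470915, 10035516, 45751396⟩,
    ⟨192, 101746, 81084, 15572376, 10116172, 45730084⟩,
    ⟨193, 102031, 81512, 15674122, 10197256, 45707916⟩,
    ⟨194, 102316, 81940, 15776153, 10278768, 45684892⟩,
    ⟨195, 102601, 82368, 15878469, 10360708, 45661012⟩,
    ⟨196, 102886, 82796, 15981070, 10443076, 45636276⟩,
    ⟨197, 103233, 83285, 16083956, 10525872, 45610684⟩,
    ⟨198, 103580, 83774, 16187189, 10609157, 45584114⟩,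
    ⟨199, 103927, 84263, 16290769, 10692931, 45556566⟩,
    ⟨200, 104274, 84752, 16394696, 10777194, 45528040⟩,
    ⟨201, 104621, 85241, 16498970, 10861946, 45498536⟩,
    ⟨202, 104968, 85730, 16603591, 10947187, 45468054⟩,
    ⟨203, 105315, 86219, 16708559, 11032917, 45436594⟩,
    ⟨204, 105662, 86708, 16813874, 11119136, 45404156⟩,
    ⟨205, 106009, 87197, 16919536, 11205844, 45370740⟩,
    ⟨206, 106356, 87686, 17025545, 11293041, 45336346⟩,
    ⟨207, 106703, 88175, 17131901, 11380727, 45300974⟩,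
    ⟨208, 107050, 88664, 17238604, 11468902, 45264624⟩,
    ⟨209, 107397, 89153, 17345654, 11557566, 45227296⟩,
    ⟨210, 107744, 89642, 17453051, 11646719, 45188990⟩,
    ⟨211, 108190, 90223, 17560795, 11736361, 45149706⟩,
    ⟨212, 108636, 90804, 17668985, 11826584, 45109260⟩,
    ⟨213, 109082, 91385, 17777621, 11917388, 45067652⟩,
    ⟨214, 109528, 91966, 17886703, 12008773, 45024882⟩,
    ⟨215, 109974, 92547, 17996231, 12100739, 44980950⟩,
    ⟨216, 110420, 93128, 18106205, 12193286, 44935856⟩,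
    ⟨217, 110866, 93709, 18216625, 12286414, 44889600⟩,
    ⟨218, 111312, 94290, 18327491, 12380123, 44842182⟩,
    ⟨219, 111758, 94871, 18438803, 12474413, 44793602⟩,
    ⟨220, 112204, 95452, 18550561, 12569284, 44743860⟩,
    ⟨221, 112650, 96033, 18662765, 12664736, 44692956⟩,
    ⟨222, 113096, 96614, 18775415, 12760769, 44640890⟩,
    ⟨223, 113542, 97195, 18888511, 12857383, 44587662⟩,
    ⟨224, 113988, 97776, 19002053, 12954578, 44533272⟩,
    ⟨225, 114484, 98467, 19116041, 13052354, 44477720⟩,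
    ⟨226, 114980, 99158, 19230525, 13150821, 44420786⟩,
    ⟨227, 115476, 99849, 19345505, 13249979, 44362470⟩,
    ⟨228, 115972, 100540, 19460981, 13349828, 44302772⟩,
    ⟨229, 116468, 101231, 19576953, 13450368, 44241692⟩,
    ⟨230, 116964, 101922, 19693421, 13551599, 44179230⟩,
    ⟨231, 117460, 102613, 19810385, 13653521, 44115386⟩,
    ⟨232, 117956, 103304, 19927845, 13756134, 44050160⟩,
    ⟨233, 118452, 103995, 20045801, 13859438, 43983552⟩,
    ⟨234, 118948, 104686, 20164253, 13963433, 43915562⟩,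
    ⟨235, 119444, 105377, 20283201, 14068119, 43846190⟩,
    ⟨236, 119940, 106068, 20402645, 14173496, 43775436⟩,
    ⟨237, 120436, 106759, 20522585, 14279564, 43703300⟩,
    ⟨238, 120932, 107450, 20643021, 14386323, 43629782⟩,
    ⟨239, 121331, 108171, 20763953, 14493773, 43554882⟩,
    ⟨240, 121730, 108892, 20885284, 14601944, 43478540⟩,
    ⟨241, 122129, 109613, 21007014, 14710836, 43400756⟩,
    ⟨242, 122528, 110334, 21129143, 14820449, 43321530⟩,
    ⟨243, 122927, 111055, 21251671, 14930783, 43240862⟩,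
    ⟨244, 123326, 111776, 21374598, 15041838, 43158752⟩,
    ⟨245, 123725, 112497, 21497924, 15153614, 43075200⟩,
    ⟨246, 124124, 113218, 21621649, 15266111, 42990206⟩,
    ⟨247, 124523, 113939, 21745773, 15379329, 42903770⟩,
    ⟨248, 124922, 114660, 21870296, 15493268, 42815892⟩,
    ⟨249, 125321, 115381, 21995218, 15607928, 42726572⟩,
    ⟨250, 125720, 116102, 22120539, 15723309, 42635810⟩,
    ⟨251, 126119, 116823, 22246259, 15839411, 42543606⟩,
    ⟨252, 126518, 117544, 22372378, 15956234, 42449960⟩,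
    ⟨253, 126984, 118298, 22498896, 16073778, 42354872⟩,
    ⟨254, 127450, 119052, 22625880, 16192076, 42258276⟩,
    ⟨255, 127916, 119806, 22753330, 16311128, 42160172⟩,
    ⟨256, 128382, 120560, 22881246, 16430934, 42060560⟩,
    ⟨257, 128848, 121314, 23009628, 16551494, 41959440⟩,
    ⟨258, 129314, 122068, 23138476, 16672808, 41856812⟩,
    ⟨259, 129780, 122822, 23267790, 16794876, 41752676⟩,
    ⟨260, 130246, 123576, 23397570, 16917698, 41647032⟩,
    ⟨261, 130712, 124330, 23527816, 17041274, 41539880⟩,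
    ⟨262, 131178, 125084, 23658528, 17165604, 41431220⟩,
    ⟨263, 131644, 125838, 23789706, 17290688, 41321052⟩,
    ⟨264, 132110, 126592, 23921350, 17416526, 41209376⟩,
    ⟨265, 132576, 127346, 24053460, 17543118, 41096192⟩,
    ⟨266, 133042, 128100, 24186036, 17670464, 40981500⟩,
    ⟨267, 133539, 128950, 24319078, 17798564, 40865300⟩,
    ⟨268, 134036, 129800, 24452617, 17927514, 40747400⟩,
    ⟨269, 134533, 130650, 24586653, 18057314, 40627800⟩,
    ⟨270, 135030, 131500, 24721186, 18187964, 40506500⟩,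
    ⟨271, 135527, 132350, 24856216, 18319464, 40383500⟩,
    ⟨272, 136024, 133200, 24991743, 18451814, 40258800⟩,
    ⟨273, 136521, 134050, 25127767, 18585014, 40132400⟩,
    ⟨274, 137018, 134900, 25264288, 18719064, 40004300⟩,
    ⟨275, 137515, 135750, 25401306, 18853964, 39874500⟩,
    ⟨276, 138012, 136600, 25538821, 18989714, 39743000⟩,
    ⟨277, 138509, 137450, 25676833, 19126314, 39609800⟩,
    ⟨278, 139006, 138300, 25815342, 19263764, 39474900⟩,
    ⟨279, 139503, 139150, 25954348, 19402064, 39338300⟩,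
    ⟨280, 140000, 140000, 26093851, 19541214, 39200000⟩]

/-- A price table for three stages. -/
def threeStageTable : List ThreeStageRow :=
  [⟨0, 26838, 19332, 12042, 0, 0, 0, 10961811, 13282635, 25710321⟩,
    ⟨1, 27051, 19500, 12147, 26838, 19332, 12042, 10939101, 13298103, 25711695⟩,
    ⟨2, 27264, 19668, 12252, 53889, 38832, 24189, 10916847, 13314924, 25713735⟩,
    ⟨3, 27477, 19836, 12357, 81153, 58500, 36441, 10894776, 13332081, 25716156⟩,
    ⟨4, 27690, 20004, 12462, 108630, 78336, 48798, 10873128, 13350024, 25718874⟩,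
    ⟨5, 27903, 20172, 12567, 136320, 98340, 61260, 10851243, 13367883, 25721862⟩,
    ⟨6, 28116, 20340, 12672, 164223, 118512, 73827, 10829781, 13386528, 25725534⟩,
    ⟨7, 28330, 20528, 12790, 192339, 138852, 86499, 10808274, 13405281, 25729371⟩,
    ⟨8, 28544, 20716, 12908, 220669, 159380, 99289, 10787484, 13424869, 25734161⟩,
    ⟨9, 28758, 20904, 13026, 249213, 180096, 112197, 10766394, 13444275, 25738887⟩,
    ⟨10, 28972, 21092, 13144, 277971, 201000, 125223, 10745736, 13464231, 25744281⟩,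
    ⟨11, 29186, 21280, 13262, 306943, 222092, 138367, 10725192, 13484419, 25750025⟩,
    ⟨12, 29400, 21468, 13380, 336129, 243372, 151629, 10704326, 13504403, 25755683⟩,
    ⟨13, 29616, 21678, 13509, 365529, 264840, 165009, 10684104, 13525149, 25762221⟩,
    ⟨14, 29832, 21888, 13638, 395145, 286518, 178518, 10663860, 13546002, 25768995⟩,
    ⟨15, 30048, 22098, 13767, 424977, 308406, 192156, 10643329, 13566697, 25775740⟩,
    ⟨16, 30264, 22308, 13896, 455025, 330504, 205923, 10623753, 13588476, 25783698⟩,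
    ⟨17, 30480, 22518, 14025, 485289, 352812, 219819, 10603908, 13610115, 25791645⟩,
    ⟨18, 30696, 22728, 14154, 515769, 375330, 233844, 10583833, 13631653, 25799620⟩,
    ⟨19, 30912, 22964, 14299, 546465, 398058, 247998, 10564695, 13657269, 25808790⟩,
    ⟨20, 31128, 23200, 14444, 577377, 421022, 262297, 10545387, 13688658, 25818080⟩,
    ⟨21, 31344, 23436, 14589, 608505, 444222, 276741, 10525694, 13721031, 25827275⟩,
    ⟨22, 31560, 23672, 14734, 639849, 467658, 291330, 10506939, 13753404, 25837698⟩,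
    ⟨23, 31776, 23908, 14879, 671409, 491330, 306064, 10488285, 13785897, 25848512⟩,
    ⟨24, 31992, 24144, 15024, 703185, 515238, 320943, 10469709, 13818519, 25860800⟩,
    ⟨25, 32178, 24412, 15183, 735177, 539382, 335967, 10453176, 13852117, 25875824⟩,
    ⟨26, 32364, 24680, 15342, 767355, 563794, 351150, 10438027, 13885861, 25891007⟩,
    ⟨27, 32550, 24948, 15501, 799719, 588474, 366492, 10422869, 13919793, 25906349⟩,
    ⟨28, 32736, 25216, 15660, 832269, 613422, 381993, 10407241, 13953849, 25921850⟩,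
    ⟨29, 32922, 25484, 15819, 865005, 638638, 397653, 10391604, 13987905, 25937510⟩,
    ⟨30, 33108, 25752, 15978, 897927, 664122, 413472, 10375497, 14023263, 25953329⟩,
    ⟨31, 33305, 26058, 16155, 931035, 689874, 429450, 10359771, 14059491, 25969307⟩,
    ⟨32, 33502, 26364, 16332, 964340, 715932, 445605, 10343612, 14095719, 25985462⟩,
    ⟨33, 33699, 26670, 16509, 997842, 742296, 461937, 10327312, 14131947, 26001794⟩,
    ⟨34, 33896, 26976, 16686, 1031541, 768966, 478446, 10310579, 14168529, 26018303⟩,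
    ⟨35, 34093, 27282, 16863, 1065437, 795942, 495132, 10294335, 14205169, 26034989⟩,
    ⟨36, 34290, 27588, 17040, 1099530, 823224, 511995, 10280264, 14242193, 26051852⟩,
    ⟨37, 34506, 27840, 17238, 1133820, 850812, 529035, 10266246, 14280639, 26066565⟩,
    ⟨38, 34722, 28092, 17436, 1168326, 878652, 546273, 10253466, 14319085, 26083530⟩,
    ⟨39, 34938, 28344, 17634, 1203048, 906744, 563709, 10240938, 14357547, 26100966⟩,
    ⟨40, 35154, 28596, 17832, 1237986, 935088, 581343, 10228305, 14396484, 26118600⟩,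
    ⟨41, 35370, 28848, 18030, 1273140, 963684, 599175, 10217736, 14435421, 26136432⟩,
    ⟨42, 35586, 29100, 18228, 1308510, 992532, 617205, 10208277, 14474701, 26154462⟩,
    ⟨43, 35818, 29218, 18448, 1344096, 1021632, 635433, 10203438, 14514129, 26172690⟩,
    ⟨44, 36050, 29336, 18668, 1379914, 1050850, 653881, 10204095, 14553900, 26191138⟩,
    ⟨45, 36282, 29454, 18888, 1415964, 1080186, 672549, 10204820, 14593819, 26209806⟩,
    ⟨46, 36514, 29572, 19108, 1452246, 1109640, 691437, 10205742, 14634081, 26228694⟩,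
    ⟨47, 36746, 29690, 19328, 1488760, 1139212, 710545, 10206354, 14674491, 26247802⟩,
    ⟨48, 36978, 29808, 19548, 1525506, 1168902, 729873, 10207163, 14714901, 26267130⟩,
    ⟨49, 37234, 29938, 19793, 1562484, 1198710, 749421, 10207662, 14755311, 26286678⟩,
    ⟨50, 37490, 30068, 20038, 1599718, 1228648, 769214, 10208283, 14795721, 26306471⟩,
    ⟨51, 37746, 30198, 20283, 1637208, 1258716, 789252, 10208169, 14836131, 26326418⟩,
    ⟨52, 38002, 30328, 20528, 1674954, 1288914, 809535, 10207320, 14876541, 26346701⟩,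
    ⟨53, 38258, 30458, 20773, 1712956, 1319242, 830063, 10205736, 14916951, 26367229⟩,
    ⟨54, 38514, 30588, 21018, 1751214, 1349700, 850836, 10203417, 14957361, 26388002⟩,
    ⟨55, 38792, 30761, 21293, 1789728, 1380288, 871854, 10200363, 14997771, 26409020⟩,
    ⟨56, 39070, 30934, 21568, 1828520, 1411049, 893147, 10196484, 15038181, 26430313⟩,
    ⟨57, 39348, 31107, 21843, 1867590, 1441983, 914715, 10191780, 15078591, 26451861⟩,
    ⟨58, 39626, 31280, 22118, 1906938, 1473090, 936558, 10186251, 15119001, 26473704⟩,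
    ⟨59, 39904, 31453, 22393, 1946564, 1504370, 958676, 10179897, 15159411, 26495822⟩,
    ⟨60, 40182, 31626, 22668, 1986468, 1535823, 981069, 10172718, 15199821, 26518215⟩,
    ⟨61, 40494, 31875, 22975, 2026650, 1567449, 1003737, 10164714, 15240333, 26540883⟩,
    ⟨62, 40806, 32124, 23282, 2067144, 1599324, 1026712, 10155789, 15281165, 26563858⟩,
    ⟨63, 41118, 32373, 23589, 2107950, 1631448, 1049994, 10145943, 15322099, 26587140⟩,
    ⟨64, 41430, 32622, 23896, 2149068, 1663821, 1073583, 10135176, 15363353, 26610729⟩,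
    ⟨65, 41742, 32871, 24203, 2190498, 1696443, 1097479, 10123488, 15404709, 26634625⟩,
    ⟨66, 42054, 33120, 24510, 2232240, 1729314, 1121682, 10110879, 15446385, 26658828⟩,
    ⟨67, 42369, 33432, 24856, 2274294, 1762434, 1146192, 10097349, 15488163, 26683365⟩,
    ⟨68, 42684, 33744, 25202, 2316663, 1795866, 1171048, 10082781, 15530261, 26708311⟩,
    ⟨69, 42999, 34056, 25548, 2359347, 1829610, 1196250, 10067175, 15572461, 26733513⟩,
    ⟨70, 43314, 34368, 25894, 2402346, 1863666, 1221798, 10050531, 15615477, 26759427⟩,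
    ⟨71, 43629, 34680, 26240, 2445660, 1898034, 1247692, 10032849, 15659235, 26786237⟩,
    ⟨72, 43944, 34992, 26586, 2489289, 1932714, 1273932, 10014129, 15703272, 26813394⟩,
    ⟨73, 44098, 35404, 26983, 2533233, 1967706, 1300518, 9994371, 15753549, 26848365⟩,
    ⟨74, 44252, 35816, 27380, 2577331, 2003110, 1327501, 9973422, 15803925, 26883769⟩,
    ⟨75, 44406, 36228, 27777, 2621583, 2038926, 1354881, 9951282, 15854833, 26919585⟩,
    ⟨76, 44560, 36640, 28174, 2665989, 2075154, 1382658, 9927951, 15905781, 26955813⟩,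
    ⟨77, 44714, 37052, 28571, 2710549, 2111794, 1410832, 9903429, 15958083, 26992453⟩,
    ⟨78, 44868, 37464, 28968, 2755263, 2148846, 1439403, 9877716, 16011389, 27029505⟩,
    ⟨79, 44985, 37955, 29443, 2800131, 2186310, 1468371, 9850812, 16065555, 27066969⟩,
    ⟨80, 45102, 38446, 29918, 2845116, 2224265, 1497814, 9822483, 16123857, 27104924⟩,
    ⟨81, 45219, 38937, 30393, 2890218, 2262711, 1527732, 9792729, 16182435, 27143370⟩,
    ⟨82, 45336, 39428, 30868, 2935437, 2301648, 1558125, 9761550, 16240662, 27182307⟩,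
    ⟨83, 45453, 39919, 31343, 2980773, 2341076, 1588993, 9728946, 16298215, 27221735⟩,
    ⟨84, 45570, 40410, 31818, 3026226, 2380995, 1620336, 9694917, 16355253, 27261621⟩,
    ⟨85, 45743, 40832, 32306, 3071796, 2421405, 1652154, 9659463, 16411617, 27300801⟩,
    ⟨86, 45916, 41254, 32794, 3117539, 2462237, 1684460, 9622545, 16467005, 27339137⟩,
    ⟨87, 46089, 41676, 33282, 3163455, 2503491, 1717254, 9584163, 16521417, 27376629⟩,
    ⟨88, 46262, 42098, 33770, 3209544, 2545167, 1750536, 9544317, 16574853, 27413277⟩,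
    ⟨89, 46435, 42520, 34258, 3255806, 2587265, 1784306, 9503007, 16627313, 27449081⟩,
    ⟨90, 46608, 42942, 34746, 3302241, 2629785, 1818564, 9460233, 16678797, 27484041⟩,
    ⟨91, 46907, 43384, 35335, 3348849, 2672727, 1853310, 9415995, 16729305, 27518157⟩,
    ⟨92, 47206, 43826, 35924, 3395756, 2716111, 1888645, 9369990, 16778635, 27551389⟩,
    ⟨93, 47505, 44268, 36513, 3442962, 2759937, 1924569, 9322218, 16826787, 27583737⟩,
    ⟨94, 47804, 44710, 37102, 3490467, 2804205, 1961082, 9272679, 16873761, 27615201⟩,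
    ⟨95, 48103, 45152, 37691, 3538271, 2848915, 1998184, 9221373, 16919557, 27645781⟩,
    ⟨96, 48402, 45594, 38280, 3586374, 2894067, 2035875, 9168300, 16964175, 27675477⟩,
    ⟨97, 48724, 46105, 38943, 3634776, 2939661, 2074155, 9113460, 17007615, 27704289⟩,
    ⟨98, 49046, 46616, 39606, 3683500, 2985766, 2113098, 9056631, 17049729, 27732079⟩,
    ⟨99, 49368, 47127, 40269, 3732546, 3032382, 2152704, 8997813, 17090517, 27758847⟩,
    ⟨100, 49690, 47638, 40932, 3781914, 3079509, 2192973, 8937006, 17129979, 27784593⟩,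
    ⟨101, 50012, 48149, 41595, 3831604, 3127147, 2233905, 8874210, 17168115, 27809317⟩,
    ⟨102, 50334, 48660, 42258, 3881616, 3175296, 2275500, 8809425, 17204925, 27833019⟩,
    ⟨103, 50860, 49232, 43049, 3931950, 3223956, 2317758, 8742651, 17240409, 27855699⟩,
    ⟨104, 51386, 49804, 43840, 3982810, 3273188, 2360807, 8673504, 17274311, 27877235⟩,
    ⟨105, 51912, 50376, 44631, 4034196, 3322992, 2404647, 8601984, 17306631, 27897627⟩,
    ⟨106, 52438, 50948, 45422, 4086108, 3373368, 2449278, 8528091, 17337369, 27916875⟩,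
    ⟨107, 52964, 51520, 46213, 4138546, 3424316, 2494700, 8451825, 17366525, 27934979⟩,
    ⟨108, 53490, 52092, 47004, 4191510, 3475836, 2540913, 8373186, 17394099, 27951939⟩,
    ⟨109, 54078, 52699, 47963, 4245000, 3527928, 2587917, 8292174, 17420091, 27967755⟩,
    ⟨110, 54666, 53306, 48922, 4299078, 3580627, 2635880, 8208285, 17444165, 27982357⟩,
    ⟨111, 55254, 53913, 49881, 4353744, 3633933, 2684802, 8121519, 17466321, 27995745⟩,
    ⟨112, 55842, 54520, 50840, 4408998, 3687846, 2734683, 8031876, 17486559, 28007919⟩,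
    ⟨113, 56430, 55127, 51799, 4464840, 3742366, 2785523, 7939356, 17504879, 28018879⟩,
    ⟨114, 57018, 55734, 52758, 4521270, 3797493, 2837322, 7843959, 17521281, 28028625⟩,
    ⟨115, 57515, 56445, 53965, 4578288, 3853227, 2890080, 7745685, 17535765, 28037157⟩,
    ⟨116, 58012, 57156, 55172, 4635803, 3909672, 2944045, 7643790, 17547835, 28044267⟩,
    ⟨117, 58509, 57867, 56379, 4693815, 3966828, 2999217, 7538274, 17557491, 28049955⟩,
    ⟨118, 59006, 58578, 57586, 4752324, 4024695, 3055596, 7429137, 17564733, 28054221⟩,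
    ⟨119, 59503, 59289, 58793, 4811330, 4083273, 3113182, 7316379, 17569561, 28057065⟩,
    ⟨120, 60000, 60000, 60000, 4870833, 4142562, 3171975, 7200000, 17571975, 28058487⟩]

theorem twoStageTable_check :
    tailsCheck (TwoStageRow.check 280 39082428 65297247) twoStageTable = true := by
  decide +kernel

theorem threeStageTable_check :
    tailsCheck (ThreeStageRow.check 120 9515925 12427686 28933638 28058487) threeStageTable = true := by
  decide +kernel

theorem exists_twoStage_prices : ∃ F : Fin 2 → ℕ → ℕ, IsPriceTable 280 140000 F ∧
    IsRatio 280 140000 F 0.6656 := by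
  obtain ⟨h1, h2⟩ := TwoStageRow.sound (last := ⟨0, 0, 0, 0, 0, 0⟩) (Q := 140000) (by decide +kernel)
    twoStageTable_check (by norm_num) (by norm_num) (by decide +kernel) (by decide +kernel)
  exact ⟨_, h1, h2 _ (by norm_num)⟩

theorem exists_threeStage_prices : ∃ F : Fin 3 → ℕ → ℕ, IsPriceTable 120 60000 F ∧
    IsRatio 120 60000 F 0.6763 := by
  obtain ⟨h1, h2⟩ := ThreeStageRow.sound (last := ⟨0, 0, 0, 0, 0, 0, 0, 0, 0, 0⟩) (Q := 60000)
    (by decide +kernel) threeStageTable_check (by norm_num) (by norm_num) (by decide +kernel)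
    (by decide +kernel)
  exact ⟨_, h1, h2 _ (by norm_num)⟩

theorem one_sub_one_div_exp_lt : 1 - 1 / Real.exp 1 < (0.6656 : ℝ) := by
  have h : 1 / (0.3344 : ℝ) > Real.exp 1 := lt_trans Real.exp_one_lt_d9 (by norm_num)
  have h2 : (0.3344 : ℝ) < 1 / Real.exp 1 := by
    rw [lt_div_iff₀ (Real.exp_pos 1)]
    have := (lt_div_iff₀ (by norm_num : (0 : ℝ) < 0.3344)).1 h
    linarith
  linarith

end StageRanking

end

theorem theorem3 :
    ((∃ f : Fin 2 → unitInterval → unitInterval, StageRanking.IsPrice f ∧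
        StageRanking.WeightedCompetitive.{u, v} 2 f (0.6656 : ℝ)) ∧
      StageRanking.ClassicalCompetitive.{u, v} 2 (0.6656 : ℝ)) ∧
    ((∃ f : Fin 3 → unitInterval → unitInterval, StageRanking.IsPrice f ∧
        StageRanking.WeightedCompetitive.{u, v} 3 f (0.6763 : ℝ)) ∧
      StageRanking.ClassicalCompetitive.{u, v} 3 (0.6763 : ℝ)) ∧
    (1 - 1 / Real.exp 1 < (0.6656 : ℝ) ∧ 1 - 1 / Real.exp 1 < (0.6763 : ℝ)) := by
  obtain ⟨F, hF, hρ⟩ := StageRanking.exists_twoStage_prices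
  obtain ⟨F', hF', hρ'⟩ := StageRanking.exists_threeStage_prices
  have hexp := StageRanking.one_sub_one_div_exp_lt
  exact ⟨⟨⟨_, hF.isPrice, hF.weightedCompetitive (by norm_num) hρ⟩,
      hF.classicalCompetitive (by norm_num) hρ⟩,
    ⟨⟨_, hF'.isPrice, hF'.weightedCompetitive (by norm_num) hρ'⟩,
      hF'.classicalCompetitive (by norm_num) hρ'⟩,
    hexp, hexp.trans (by norm_num)⟩
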